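/- Let $I$ be a set, $\mathcal U$ an ultrafilter on $I$, and $(n_i)_{i\in I}$ natural numbers with $n_i\to_{\mathcal U}\infty$. For groups $H_i$ with conjugation-invariant norms $\ell_i$, the metric ultraproduct is $\prod_{i\in I}H_i\big/\{(h_i)_{i\in I} : \lim_{\mathcal U}\ell_i(h_i)=0\}$, and for subgroups $K_i\le H_i$ we write $\prod_{\mathcal U}K_i$ for the image of $\prod_{i\in I}K_i$ in it. Let $\mathbf C(\cdot)$ denote centralizers. Let $\mathrm S_{\mathcal U}$ be the metric ultraproduct of the symmetric groups $\mathrm S_{n_i}$ with the normalized Hamming norm $\ell_{\mathrm H}(\sigma)=|\mathrm{supp}(\sigma)|/n_i$. Fix a prime power $q$, and let $\mathrm{GL}_{\mathcal U}(q)$, $\mathrm{Sp}_{\mathcal U}(q)$, $\mathrm{GO}_{\mathcal U}(q)$, $\mathrm{GU}_{\mathcal U}(q)$ be the metric ultraproducts, with respect to the normalized rank norm $\ell_{\mathrm{rk}}(g)=\mathrm{rk}(1-g)/n_i$, of respectively: the general linear groups $\mathrm{GL}_{n_i}(\mathbb F_q)$; the isometry groups of non-degenerate alternating bilinear forms $f_i$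 on $\mathbb F_q^{n_i}$; the isometry groups of quadratic forms $Q_i$ on $\mathbb F_q^{n_i}$ with non-degenerate polar form; the isometry groups of non-degenerate Hermitian forms $f_i$ (with respect to $x\mapsto x^q$) on $\mathbb F_{q^2}^{n_i}$. Here the forms may be chosen arbitrarily for each $i\in I$. An element of one of the finite classical groups $H_i$ is called semisimple if its order is prime to $q$, and an element of the metric ultraproduct is called semisimple if it has a representative $(g_i)_{i\in I}\in\prod_{i\in I}H_i$ with all $g_i$ semisimple. (a) If $\sigma\in \mathrm S_{\mathcal U}$ has finite order, then $\mathbf C(\sigma)=\prod_{\mathcal U}\mathbf C(\sigma_i)$ for every representative $(\sigma_i)_{i\in I}$ of $\sigma$. (b) If $g$ is a semisimple element of finite order in $\mathrm{GL}_{\mathcal U}(q)$, $\mathrm{Sp}_{\mathcal U}(q)$, $\mathrm{GO}_{\mathcal U}(q)$ or $\mathrm{GU}_{\mathcal U}(q)$, then $\mathbf C(g)=\prod_{\mathcal U}\mathbf C(g_i)$ for every representative $(g_i)_{i\in I}$ of $g$ all of whose components $g_i\in H_i$ are semisimple. Here $\mathbf C(g_i)$ is the centralizer in $H_i$ and $\mathbf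 C(g)$ the centralizer in the metric ultraproduct. -/

import Mathlib

open Filter Topology

noncomputable section

namespace MetUltra

/-! ## Normed groups and their metric ultraproducts -/

/-- A (real-valued) norm on a group that is invariant under conjugation. -/
structure ConjInvNorm (H : Type*) [Group H] extends GroupNorm H where
  conj_inv : ∀ g h : H, toFun (g * h * g⁻¹) = toFun h

namespace ConjInvNorm

variable {H : Type*} [Group H] (l : ConjInvNorm H)

theorem nonneg (h : H) : 0 ≤ l.toFun h := by
  have h1 := l.mul_le' h h⁻¹
  rw [mul_inv_cancel, l.map_one', l.inv'] at h1
  linarith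

/-- The restriction of a norm to a subgroup. -/
def restrict (K : Subgroup H) : ConjInvNorm K where
  toFun k := l.toFun (k : H)
  map_one' := l.map_one'
  mul_le' x y := l.mul_le' x y
  inv' x := l.inv' x
  eq_one_of_map_eq_zero' x hx := Subtype.ext (l.eq_one_of_map_eq_zero' x hx)
  conj_inv g h := l.conj_inv g h

end ConjInvNorm

section Ultraproduct

variable {I : Type*} (U : Ultrafilter I) {H : I → Type*} [∀ i, Group (H i)]
  (l : ∀ i, ConjInvNorm (H i))

/-- The subgroup of all sequences `(hᵢ)` whose norms `ℓᵢ(hᵢ)` tend to `0` along `U`. -/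
def nullSubgroup : Subgroup (∀ i, H i) where
  carrier := {h | Tendsto (fun i => (l i).toFun (h i)) U (𝓝 0)}
  one_mem' := by
    have : (fun i => (l i).toFun ((1 : ∀ i, H i) i)) = fun _ => (0 : ℝ) :=
      funext fun i => (l i).map_one'
    simp only [Set.mem_ofPred_eq, this]
    exact tendsto_const_nhds
  mul_mem' := by
    intro a b ha hb
    have hab := Tendsto.add ha hb
    rw [add_zero] at hab
    exact squeeze_zero (fun i => (l i).nonneg _) (fun i => (l i).mul_le' (a i) (b i)) hab
  inv_mem' := by
    intro a ha
    have : (fun i => (l i).toFun (a⁻¹ i)) = fun i => (l i).toFun (a i) :=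
      funext fun i => (l i).inv' (a i)
    simp only [Set.mem_ofPred_eq, this]
    exact ha

instance nullSubgroup_normal : (nullSubgroup U l).Normal where
  conj_mem := by
    intro a ha g
    have : (fun i => (l i).toFun ((g * a * g⁻¹) i)) = fun i => (l i).toFun (a i) :=
      funext fun i => (l i).conj_inv (g i) (a i)
    change Tendsto (fun i => (l i).toFun ((g * a * g⁻¹) i)) U (𝓝 0)
    rw [this]
    exact ha

/-- The metric ultraproduct of the normed groups `(Hᵢ, ℓᵢ)` along `U`. -/
abbrev MetricUltraproduct : Type _ := (∀ i, H i) ⧸ nullSubgroup U l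

/-- The element of the metric ultraproduct represented by a sequence. -/
abbrev mk : (∀ i, H i) →* MetricUltraproduct U l := QuotientGroup.mk' (nullSubgroup U l)

/-- The metric ultraproduct of a sequence of subgroups `Kᵢ ≤ Hᵢ`, as a subgroup of the metric
ultraproduct of the `Hᵢ`: all elements having a representative in `∏ᵢ Kᵢ`. -/
def ultraproductSubgroup (K : ∀ i, Subgroup (H i)) : Subgroup (MetricUltraproduct U l) :=
  (Subgroup.pi Set.univ K).map (mk U l)

/-- An element `h` of a finite group is semisimple with respect to a prime power `q` if its order
is prime to `q`. -/
def IsSemisimpleElt {H : Type*} [Group H] (q : ℕ) (h : H) : Prop := (orderOf h).Coprime q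

/-- An element of the metric ultraproduct is semisimple if it has a representative all of whose
components are semisimple. -/
def IsSemisimple (q : ℕ) (g : MetricUltraproduct U l) : Prop :=
  ∃ r : ∀ i, H i, mk U l r = g ∧ ∀ i, IsSemisimpleElt q (r i)

end Ultraproduct

/-! ## Symmetric groups -/

/-- The normalized Hamming norm `|supp σ| / n` on the symmetric group of degree `n`. -/
def hammingNorm (n : ℕ) : ConjInvNorm (Equiv.Perm (Fin n)) where
  toFun s := (s.support.card : ℝ) / n
  map_one' := by simp
  mul_le' s t := by
    rw [← add_div]
    gcongr
    have h1 := Finset.card_le_card (Equiv.Perm.support_mul_le s t)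
    have h2 := Finset.card_union_le s.support t.support
    exact_mod_cast h1.trans h2
  inv' s := by simp
  eq_one_of_map_eq_zero' s hs := by
    rcases Nat.eq_zero_or_pos n with rfl | hn
    · exact Subsingleton.elim _ _
    · have hn' : (n : ℝ) ≠ 0 := by exact_mod_cast hn.ne'
      simpa [hn', hn.ne'] using hs
  conj_inv s t := by simp

/-! ## Classical groups -/

section Classical

variable (k : Type*) [Field k]

/-- The natural module `kⁿ`. -/
abbrev Vec (n : ℕ) : Type _ := Fin n → k

/-- The general linear group `GL_n(k)`. -/
abbrev GLn (n : ℕ) : Type _ := LinearMap.GeneralLinearGroup k (Vec k n)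

variable {k}

/-- The rank of an endomorphism of `kⁿ`. -/
def rk {n : ℕ} (A : Module.End k (Vec k n)) : ℕ := Module.finrank k (LinearMap.range A)

theorem rk_add_le {n : ℕ} (A B : Module.End k (Vec k n)) : rk (A + B) ≤ rk A + rk B := by
  have h := LinearMap.rank_add_le A B
  simp only [LinearMap.rank, ← Module.finrank_eq_rank] at h
  exact_mod_cast h

theorem rk_mul_le_left {n : ℕ} (A B : Module.End k (Vec k n)) : rk (A * B) ≤ rk A := by
  have h := LinearMap.rank_comp_le_left B A
  simp only [LinearMap.rank, ← Module.finrank_eq_rank] at h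
  exact_mod_cast h

theorem rk_mul_le_right {n : ℕ} (A B : Module.End k (Vec k n)) : rk (A * B) ≤ rk B := by
  have h := LinearMap.rank_comp_le_right B A
  simp only [LinearMap.rank, ← Module.finrank_eq_rank] at h
  exact_mod_cast h

theorem rk_one_sub_inv_le {n : ℕ} (g : GLn k n) :
    rk (1 - ((g⁻¹ : GLn k n) : Module.End k (Vec k n))) ≤
      rk (1 - (g : Module.End k (Vec k n))) := by
  have h : (1 - ((g⁻¹ : GLn k n) : Module.End k (Vec k n))) =
      (-((g⁻¹ : GLn k n) : Module.End k (Vec k n))) * (1 - (g : Module.End k (Vec k n))) := by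
    have e : ∀ a b : Module.End k (Vec k n), a * b = 1 → 1 - a = (-a) * (1 - b) := by
      intro a b hab
      rw [← hab]
      refine LinearMap.ext fun x => ?_
      have hx : a (b x) = x := LinearMap.congr_fun hab x
      simp [hx, sub_eq_add_neg, add_comm]
    exact e _ _ (Units.inv_mul g)
  rw [h]
  exact rk_mul_le_right _ _

theorem rk_one_sub_conj_le {n : ℕ} (g h : GLn k n) :
    rk (1 - ((g * h * g⁻¹ : GLn k n) : Module.End k (Vec k n))) ≤
      rk (1 - (h : Module.End k (Vec k n))) := by
  have e : (1 - ((g * h * g⁻¹ : GLn k n) : Module.End k (Vec k n))) =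
      (g : Module.End k (Vec k n)) * (1 - (h : Module.End k (Vec k n))) *
        ((g⁻¹ : GLn k n) : Module.End k (Vec k n)) := by
    rw [mul_sub, sub_mul, mul_one, Units.mul_inv, Units.val_mul, Units.val_mul]
  rw [e]
  exact (rk_mul_le_left _ _).trans (rk_mul_le_right _ _)

variable (k)

/-- The normalized rank norm `rk(1 - g) / n` on `GL_n(k)`. -/
def rankNorm (n : ℕ) : ConjInvNorm (GLn k n) where
  toFun g := (rk (1 - (g : Module.End k (Vec k n))) : ℝ) / n
  map_one' := by
    have : rk (0 : Module.End k (Vec k n)) = 0 := by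
      simp [rk]
    simp [this]
  mul_le' g h := by
    rw [← add_div]
    gcongr
    have e : (1 - ((g * h : GLn k n) : Module.End k (Vec k n))) =
        (1 - (g : Module.End k (Vec k n))) +
          (g : Module.End k (Vec k n)) * (1 - (h : Module.End k (Vec k n))) := by
      rw [mul_sub, mul_one, Units.val_mul]
      abel
    rw [e]
    exact_mod_cast (rk_add_le _ _).trans (Nat.add_le_add_left (rk_mul_le_right _ _) _)
  inv' g := by
    have h1 := rk_one_sub_inv_le g
    have h2 := rk_one_sub_inv_le g⁻¹
    rw [inv_inv] at h2
    rw [le_antisymm h1 h2]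
  eq_one_of_map_eq_zero' g hg := by
    rcases Nat.eq_zero_or_pos n with rfl | hn
    · exact Units.ext (Subsingleton.elim _ _)
    · have hn' : (n : ℝ) ≠ 0 := by exact_mod_cast hn.ne'
      have h0 : rk (1 - (g : Module.End k (Vec k n))) = 0 := by
        rcases div_eq_zero_iff.mp hg with h | h
        · exact_mod_cast h
        · exact absurd h hn'
      have h1 := LinearMap.range_eq_bot.mp (Submodule.finrank_eq_zero.mp h0)
      exact Units.ext (sub_eq_zero.mp h1).symm
  conj_inv g h := by
    have h1 := rk_one_sub_conj_le g h
    have h2 := rk_one_sub_conj_le g⁻¹ (g * h * g⁻¹)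
    have e : g⁻¹ * (g * h * g⁻¹) * g⁻¹⁻¹ = h := by group
    rw [e] at h2
    rw [le_antisymm h1 h2]

variable {k}

/-- The group of all invertible linear maps of `kⁿ` preserving a form `f` that is semilinear along
`s` in the first argument and linear in the second one. For `f` non-degenerate and alternating
(with `s = id`) this is the symplectic group of `f`; for `f` non-degenerate and Hermitian it is the
unitary group of `f`. -/
def isometryGroup {n : ℕ} {s : k →+* k} (f : Vec k n →ₛₗ[s] Vec k n →ₗ[k] k) :
    Subgroup (GLn k n) where
  carrier := {g | ∀ v w, f ((g : Module.End k (Vec k n)) v) ((g : Module.End k (Vec k n)) w) = f v w}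
  one_mem' := fun _ _ => rfl
  mul_mem' := by
    intro a b ha hb v w
    exact (ha _ _).trans (hb v w)
  inv_mem' := by
    intro a ha v w
    have key : ∀ x, (a : Module.End k (Vec k n)) (((a⁻¹ : GLn k n) : Module.End k (Vec k n)) x) = x :=
      fun x => LinearMap.congr_fun (Units.mul_inv a) x
    have h := ha (((a⁻¹ : GLn k n) : Module.End k (Vec k n)) v)
      (((a⁻¹ : GLn k n) : Module.End k (Vec k n)) w)
    rw [key, key] at h
    exact h.symm

/-- The group of all invertible linear maps of `kⁿ` preserving a quadratic form `Q`. If the polar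
form of `Q` is non-degenerate, this is the general orthogonal group of `Q`. -/
def orthogonalGroup {n : ℕ} (Q : QuadraticForm k (Vec k n)) : Subgroup (GLn k n) where
  carrier := {g | ∀ v, Q ((g : Module.End k (Vec k n)) v) = Q v}
  one_mem' := fun _ => rfl
  mul_mem' := by
    intro a b ha hb v
    exact (ha _).trans (hb v)
  inv_mem' := by
    intro a ha v
    have key : ∀ x, (a : Module.End k (Vec k n)) (((a⁻¹ : GLn k n) : Module.End k (Vec k n)) x) = x :=
      fun x => LinearMap.congr_fun (Units.mul_inv a) x
    have h := ha (((a⁻¹ : GLn k n) : Module.End k (Vec k n)) v)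
    rw [key] at h
    exact h.symm

end Classical

/-- The `q`-Frobenius endomorphism `x ↦ x ^ q` of an extension `E` of a field `F` with `q`
elements. -/
abbrev qFrob (F E : Type*) [Field F] [Fintype F] [Field E] [Algebra F E] : E →+* E :=
  (FiniteField.frobeniusAlgHom F E : E →+* E)

/-! ## The statement about centralizers -/

/-- Every torsion element `g` of the metric ultraproduct has the property that, for every
representative of it, the centralizer of `g` is the metric ultraproduct of the centralizers of the
components. -/
def TorsionCentralizersSplit {I : Type*} (U : Ultrafilter I) {H : I → Type*} [∀ i, Group (H i)]
    (l : ∀ i, ConjInvNorm (H i)) : Prop :=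
  ∀ g : MetricUltraproduct U l, IsOfFinOrder g →
    ∀ r : ∀ i, H i, mk U l r = g →
      Subgroup.centralizer {g} =
        ultraproductSubgroup U l (fun i => Subgroup.centralizer {r i})

/-- Every semisimple torsion element `g` of the metric ultraproduct has the property that, for
every representative of it with semisimple components, the centralizer of `g` is the metric
ultraproduct of the centralizers of the components. -/
def SemisimpleTorsionCentralizersSplit {I : Type*} (U : Ultrafilter I) {H : I → Type*}
    [∀ i, Group (H i)] (l : ∀ i, ConjInvNorm (H i)) (q : ℕ) : Prop :=
  ∀ g : MetricUltraproduct U l, IsSemisimple U l q g → IsOfFinOrder g →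
    ∀ r : ∀ i, H i, mk U l r = g → (∀ i, IsSemisimpleElt q (r i)) →
      Subgroup.centralizer {g} =
        ultraproductSubgroup U l (fun i => Subgroup.centralizer {r i})

end MetUltra

end

/-!
Let `t` almost commute with `r`, where `r ^ N` is almost `1`. Then `r' = t⁻¹ r t` is a conjugate of
`r` that agrees with `r` on a large `r`-invariant part `W` of the underlying set or space: the
points fixed by `r ^ N` on whose `r`-orbit `r` and `r'` agree. If some `ρ` in the group is the
identity on most of `W` and conjugates `r` to `r'`, then `t ρ` commutes with `r` and is close to
`t`. The bounds are linear with a constant depending on `N` only, so the metric ultraproduct of the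
centralizers is the whole centralizer (`centralizer_eq_of_conj_bound`).

For permutations, `r` and `r'` have the same cycle type on the complement of `W`
(`exists_conj_of_isConj_of_eqOn`). For linear groups, semisimplicity gives invariant complements,
and for isometry groups it also allows one to shrink `W` to a nondegenerate invariant subspace, of
which one takes the orthogonal complement (`exists_nondegenerate_invtSubmodule`). What remains is to
cancel `W`: from an equivariant isometry between `W ⊥ (X, r')` and `W ⊥ (X, r)`, find one between
`(X, r')` and `(X, r)`.

This equivariant Witt cancellation works in all characteristics by counting over finite fields
(`exists_isometry_of_prod_isometry`). For each character of the group of functions on `X × X`, the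
sum over equivariant maps `φ` from `X` of the character at the form pulled back by `φ` is
multiplicative in orthogonal sums of the target. It is a Gauss sum, and it is nonzero for the target
`W` provided that the form is `D p = polar D (T p) p` for an equivariant `T`
(`charSum_ne_zero_of_polar`). Hence it can be cancelled, and Fourier inversion shows that there is a
form-preserving equivariant map from `(X, r)` to `(X, r')`, because the identity of `(X, r)` is
one to `(X, r)`. The operator `T` exists for alternating and quadratic forms by a triangular Gram
matrix and for Hermitian forms by an element of trace one; averaging over the powers of `r` makes it
equivariant (`exists_commuting_polar_eq`), as the order of `r` is prime to the characteristic.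
-/

namespace MetUltra

/-! ### Cancellation by character sums -/

section Cancellation

open QuadraticMap (polar)

/-- Fourier inversion: the number of `c` with `z c = v`, written with the character sums of `z`. -/
theorem sum_charSum {P Z : Type*} [AddCommGroup P] [Fintype P] [DecidableEq P] [Fintype Z]
    (z : Z → P) (v : P) : ∑ ψ : AddChar P ℂ, ψ (-v) * ∑ c, ψ (z c) =
      Fintype.card P * (Finset.univ.filter fun c => z c = v).card := by
  simp only [Finset.mul_sum, ← AddChar.map_add_eq_mul]
  rw [Finset.sum_comm]
  simp only [AddChar.sum_apply_eq_ite, neg_add_eq_zero]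
  simp [Finset.sum_ite, mul_comm, eq_comm]

/-- If a bijection `A × Y ≃ A × X` matches `w + y` with `w + x`, then the character sums of `y` and
of `x` agree after multiplication by those of `w`. When the latter never vanish they can be
cancelled, so `x` and `y` take every value equally often. -/
theorem exists_eq_of_charSum_ne_zero {A P : Type*} {X Y : Type*} [Finite A] [Finite X] [Finite Y]
    [AddCommGroup P] [Finite P] (e : A × Y ≃ A × X) (w : A → P) (x : X → P) (y : Y → P)
    (he : ∀ p, w (e p).1 + x (e p).2 = w p.1 + y p.2)
    (hw : ∀ [Fintype A] (ψ : AddChar P ℂ), ∑ a, ψ (w a) ≠ 0) (b : X) : ∃ c, y c = x b := by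
  classical
  have := Fintype.ofFinite A
  have := Fintype.ofFinite X
  have := Fintype.ofFinite Y
  have := Fintype.ofFinite P
  have hsum (ψ : AddChar P ℂ) : ∑ c, ψ (y c) = ∑ b, ψ (x b) := by
    apply mul_left_cancel₀ (hw ψ)
    simp only [Finset.sum_mul_sum, ← AddChar.map_add_eq_mul, ← Fintype.sum_prod_type']
    rw [← e.sum_comp]
    exact Finset.sum_congr rfl fun p _ => by rw [he]
  have hx : ∑ ψ : AddChar P ℂ, ψ (-x b) * ∑ c, ψ (x c) =
      Fintype.card P * (Finset.univ.filter fun c => x c = x b).card := sum_charSum x (x b)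
  have hy : ∑ ψ : AddChar P ℂ, ψ (-x b) * ∑ c, ψ (y c) =
      Fintype.card P * (Finset.univ.filter fun c => y c = x b).card := sum_charSum y (x b)
  simp only [hsum, hx] at hy
  have h2 : (Fintype.card P : ℂ) ≠ 0 := by simp
  have h3 := Nat.cast_injective (mul_left_cancel₀ h2 hy)
  have h4 : 0 < (Finset.univ.filter fun c => x c = x b).card :=
    Finset.card_pos.2 ⟨b, by simp⟩
  rw [h3] at h4
  obtain ⟨c, hc⟩ := Finset.card_pos.1 h4
  exact ⟨c, by simpa using hc⟩

/-- Gauss sums of a quadratic map `w` do not vanish if `w a` is always a value of the form `polar w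
t a`. The absolute square of the sum is a multiple of the sum of `ψ ∘ w` over the radical of `ψ ∘
polar w`, and by this hypothesis `ψ ∘ w` is trivial there. -/
theorem charSum_ne_zero_of_polar {A P : Type*} [AddCommGroup A] [Fintype A] [AddCommGroup P]
    [Finite P] (w : A → P)
    (hadd : ∀ a b c, polar w (a + b) c = polar w a c + polar w b c)
    (ht : ∀ a, ∃ t, w a = polar w t a) (ψ : AddChar P ℂ) : ∑ a, ψ (w a) ≠ 0 := by
  classical
  let χ (b : A) : AddChar A ℂ :=
    ψ.compAddMonoidHom (AddMonoidHom.mk' (fun a => polar w a b) fun a c => hadd a c b)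
  have hχ (b a : A) : χ b a = ψ (polar w a b) := rfl
  intro h0
  -- This is the sum times its complex conjugate, with the summation indices `c` and `c + b`.
  have hsq : ∑ b : A, ψ (w b) * ∑ c, χ b c = 0 := by
    have : ∑ b : A, ψ (w b) * ∑ c, χ b c = ∑ c, ∑ b, ψ (w (c + b)) * ψ (-w c) := by
      simp only [Finset.mul_sum]
      rw [Finset.sum_comm]
      refine Finset.sum_congr rfl fun c _ => Finset.sum_congr rfl fun b _ => ?_
      rw [hχ, ← AddChar.map_add_eq_mul, ← AddChar.map_add_eq_mul, polar]
      congr 1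
      abel
    rw [this]
    refine Finset.sum_eq_zero fun c _ => ?_
    rw [← Finset.sum_mul,
      show ∑ b, ψ (w (c + b)) = 0 from
        (Equiv.sum_comp (Equiv.addLeft c) fun b => ψ (w b)).trans h0, zero_mul]
  have hterm (b : A) : ψ (w b) * ∑ c, χ b c = if χ b = 0 then (Fintype.card A : ℂ) else 0 := by
    rw [AddChar.sum_eq_ite]
    split_ifs with h
    -- If `b` lies in the radical, then `ψ (w b) = ψ (polar w t b) = 1`.
    · obtain ⟨t, ht⟩ := ht b
      rw [ht, ← hχ, h, AddChar.zero_apply, one_mul]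
    · rw [mul_zero]
  simp only [hterm] at hsq
  rw [← Finset.sum_filter, Finset.sum_const, nsmul_eq_mul, mul_eq_zero] at hsq
  have hA : (Fintype.card A : ℂ) ≠ 0 := by simp
  have hz : χ 0 = 0 := by
    have h1 : ∀ a, polar w a 0 = polar w 0 a := fun a => QuadraticMap.polar_comm _ _ _
    have h2 : ∀ a, polar w 0 a = 0 := fun a => by simpa using hadd 0 0 a
    ext a
    rw [hχ, h1, h2]
    simp
  refine hsq.elim (fun h => ?_) hA
  have : (Finset.univ.filter fun b => χ b = 0).card = 0 := by exact_mod_cast h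
  rw [Finset.card_eq_zero] at this
  exact Finset.notMem_empty (0 : A) (this ▸ by simp [hz])

variable {R : Type*} [Ring R] {W X Y : Type*} [AddCommGroup W] [Module R W] [Finite W]
  [AddCommGroup X] [Module R X] [Finite X] [AddCommGroup Y] [Module R Y] [Finite Y]

instance finite_linearMap : Finite (W →ₗ[R] X) :=
  Finite.of_injective (fun f => (f : W → X)) DFunLike.coe_injective

/-- An isomorphism `W × Y ≃ W × X`, applied to pairs of homomorphisms from `S`. -/
def homProdEquiv (S : Type*) [AddCommGroup S] [Module R S] (e : (W × Y) ≃ₗ[R] (W × X)) :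
    ((S →ₗ[R] W) × (S →ₗ[R] Y)) ≃ ((S →ₗ[R] W) × (S →ₗ[R] X)) where
  toFun p := (LinearMap.fst R W X ∘ₗ e.toLinearMap ∘ₗ p.1.prod p.2,
    LinearMap.snd R W X ∘ₗ e.toLinearMap ∘ₗ p.1.prod p.2)
  invFun p := (LinearMap.fst R W Y ∘ₗ e.symm.toLinearMap ∘ₗ p.1.prod p.2,
    LinearMap.snd R W Y ∘ₗ e.symm.toLinearMap ∘ₗ p.1.prod p.2)
  left_inv p := by ext s <;> simp
  right_inv p := by ext s <;> simp

/-- An isomorphism `W × Y ≃ W × X`, applied to pairs of homomorphisms to `S`. -/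
def homCoprodEquiv (S : Type*) [AddCommGroup S] [Module R S] (e : (W × Y) ≃ₗ[R] (W × X)) :
    ((W →ₗ[R] S) × (Y →ₗ[R] S)) ≃ ((W →ₗ[R] S) × (X →ₗ[R] S)) :=
  (LinearMap.coprodEquiv ℕ).toEquiv.trans
    ((e.congrLeft S ℕ).toEquiv.trans (LinearMap.coprodEquiv ℕ).symm.toEquiv)

/-- Witt cancellation for finite modules: if `W ⊥ Y` and `W ⊥ X` are isometric, then `X` maps
isometrically to `Y`. Here `D` is a quadratic map on pairs of vectors, such as `f v w` for a
bilinear form or `Q v` for a quadratic form. Homomorphisms `φ : X → W` are sorted by the form that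
they induce on `X`; this gives a quadratic map on `Hom(X, W)` whose Gauss sums do not vanish, so
the forms induced by `Hom(X, Y)` are those induced by `Hom(X, X)`, and the identity yields `φ`. -/
theorem exists_isometry_of_prod_isometry {P : Type*} [AddCommGroup P] [Finite P]
    (e : (W × Y) ≃ₗ[R] (W × X)) (DW : W × W → P) (DX : X × X → P) (DY : Y × Y → P)
    (he : ∀ p q : W × Y, DW ((e p).1, (e q).1) + DX ((e p).2, (e q).2) =
      DW (p.1, q.1) + DY (p.2, q.2))
    (hadd : ∀ a b c, polar DW (a + b) c = polar DW a c + polar DW b c)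
    (T : W →ₗ[R] W) (hT : ∀ p, DW p = polar DW (T p.1, T p.2) p) :
    ∃ φ : X →ₗ[R] Y, ∀ s t, DY (φ s, φ t) = DX (s, t) := by
  let w (φ : X →ₗ[R] W) : X → X → P := fun s t => DW (φ s, φ t)
  have hpol (φ η : X →ₗ[R] W) (s t : X) :
      polar w φ η s t = polar DW (φ s, φ t) (η s, η t) := rfl
  obtain ⟨φ, hφ⟩ := exists_eq_of_charSum_ne_zero (homProdEquiv X e) w
    (fun (φ : X →ₗ[R] X) s t => DX (φ s, φ t)) (fun (φ : X →ₗ[R] Y) s t => DY (φ s, φ t))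
    (fun p => by
      funext s t
      exact he (p.1 s, p.2 s) (p.1 t, p.2 t))
    (fun ψ => charSum_ne_zero_of_polar w
      (fun a b c => by
        funext s t
        exact hadd (a s, a t) (b s, b t) (c s, c t))
      (fun a => ⟨T ∘ₗ a, by
        funext s t
        exact hT (a s, a t)⟩) ψ) LinearMap.id
  exact ⟨φ, fun s t => congrFun (congrFun hφ s) t⟩

/-- Cancellation for finite modules, by the same count applied to pairs of homomorphisms
`X → W → X`, sorted by their composition: as the identity of `X` factors through `X`, it factors
through `Y`. -/
theorem nonempty_linearEquiv_of_prod (e : (W × Y) ≃ₗ[R] (W × X)) : Nonempty (X ≃ₗ[R] Y) := by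
  let w (p : (X →ₗ[R] W) × (W →ₗ[R] X)) : X → X := fun s => p.2 (p.1 s)
  have hpol (p q : (X →ₗ[R] W) × (W →ₗ[R] X)) (s : X) :
      polar w p q s = q.2 (p.1 s) + p.2 (q.1 s) := by
    simp [polar, w]
    abel
  let E : (((X →ₗ[R] W) × (W →ₗ[R] X)) × ((X →ₗ[R] Y) × (Y →ₗ[R] X))) ≃
      (((X →ₗ[R] W) × (W →ₗ[R] X)) × ((X →ₗ[R] X) × (X →ₗ[R] X))) :=
    (Equiv.prodProdProdComm _ _ _ _).trans <|
      ((homProdEquiv X e).prodCongr (homCoprodEquiv X e)).trans (Equiv.prodProdProdComm _ _ _ _)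
  obtain ⟨⟨φ, η⟩, h⟩ := exists_eq_of_charSum_ne_zero E w
    (fun p s => p.2 (p.1 s)) (fun p s => p.2 (p.1 s))
    (fun p => by
      funext s
      change (p.1.2.coprod p.2.2) (e.symm (LinearMap.inl R W X (e (p.1.1 s, p.2.1 s)).1)) +
        (p.1.2.coprod p.2.2) (e.symm (LinearMap.inr R W X (e (p.1.1 s, p.2.1 s)).2)) =
        (p.1.2.coprod p.2.2) (p.1.1 s, p.2.1 s)
      rw [← map_add, ← map_add]
      simp)
    (fun ψ => charSum_ne_zero_of_polar w
      (fun a b c => by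
        funext s
        simp [hpol]
        abel)
      (fun a => ⟨(a.1, 0), by
        funext s
        simp [hpol, w]⟩) ψ) (LinearMap.id, LinearMap.id)
  have hinj : Function.Injective φ := (Function.LeftInverse.injective (g := η) (congrFun h))
  have hcard : Nat.card X = Nat.card Y := by
    have := Nat.card_congr e.toEquiv
    rw [Nat.card_prod, Nat.card_prod] at this
    exact (Nat.eq_of_mul_eq_mul_left Nat.card_pos this).symm
  exact ⟨LinearEquiv.ofBijective φ
    ((Nat.bijective_iff_injective_and_card φ).2 ⟨hinj, hcard⟩)⟩

end Cancellation

/-! ### From uniform bounds to the metric ultraproduct -/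

section Reduction

variable {I : Type*} (U : Ultrafilter I) {H : I → Type*} [∀ i, Group (H i)]
  (l : ∀ i, ConjInvNorm (H i))

theorem mk_eq_mk_iff (a b : ∀ i, H i) :
    mk U l a = mk U l b ↔ Tendsto (fun i => (l i).toFun ((a i)⁻¹ * b i)) U (𝓝 0) :=
  QuotientGroup.eq

/-- The centralizer splits as soon as, in every component, a conjugate `t⁻¹ r t` of `r` that is
close to `r` is conjugate to `r` by an element `ρ` that is close to `1`, with a linear bound: then
`t ρ` centralizes `r` and represents the same element as `t`. -/
theorem centralizer_eq_of_conj_bound (r : ∀ i, H i) (N : ℕ) (hN : mk U l r ^ N = 1) (C : ℝ)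
    (hC : ∀ i (t : H i), ∃ ρ : H i, ρ * r i * ρ⁻¹ = t⁻¹ * r i * t ∧
      (l i).toFun ρ ≤ C * ((l i).toFun (r i ^ N) + (l i).toFun ((r i)⁻¹ * (t⁻¹ * r i * t)))) :
    Subgroup.centralizer {mk U l r} =
      ultraproductSubgroup U l (fun i => Subgroup.centralizer {r i}) := by
  ext x
  rw [Subgroup.mem_centralizer_singleton_iff]
  constructor
  · obtain ⟨t, rfl⟩ := QuotientGroup.mk'_surjective (nullSubgroup U l) x
    intro hx
    have h1 : Tendsto (fun i => (l i).toFun ((r i)⁻¹ * ((t i)⁻¹ * r i * t i))) U (𝓝 0) := by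
      have h := ((mk_eq_mk_iff U l (t * r) (r * t)).1 (by rw [map_mul, map_mul]; exact hx))
      simpa [mul_assoc] using h
    have h2 : Tendsto (fun i => (l i).toFun (r i ^ N)) U (𝓝 0) := by
      have h := ((mk_eq_mk_iff U l 1 (r ^ N)).1 (by rw [map_pow, hN, map_one]))
      simpa using h
    choose ρ hρ hle using fun i => hC i (t i)
    refine ⟨fun i => t i * ρ i, ?_, ?_⟩
    · intro i _
      refine Subgroup.mem_centralizer_singleton_iff.2 ?_
      have h := hρ i
      rw [mul_inv_eq_iff_eq_mul, mul_assoc, mul_assoc] at h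
      rw [mul_assoc, h]
      group
    · refine ((mk_eq_mk_iff U l t fun i => t i * ρ i).2 ?_).symm
      refine squeeze_zero (fun i => (l i).nonneg _) (fun i => ?_)
        (by simpa using (h2.add h1).const_mul C)
      rw [inv_mul_cancel_left]
      exact hle i
  · rintro ⟨t, ht, rfl⟩
    rw [← map_mul, ← map_mul]
    congr 1
    funext i
    exact Subgroup.mem_centralizer_singleton_iff.1 (ht i trivial)

end Reduction

/-! ### Permutations -/

section Permutations

open Equiv Equiv.Perm

variable {α : Type*} [Fintype α] [DecidableEq α]

theorem cycleType_eq_add_subtypePerm (σ : Perm α) (p : α → Prop) [DecidablePred p]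
    (h : ∀ x, p (σ x) ↔ p x) :
    σ.cycleType = (σ.subtypePerm h).cycleType +
      (σ.subtypePerm (p := fun x => ¬ p x) fun x => not_congr (h x)).cycleType := by
  have hd : Perm.Disjoint (ofSubtype (σ.subtypePerm h))
      (ofSubtype (σ.subtypePerm (p := fun x => ¬ p x) fun x => not_congr (h x))) := by
    intro x
    by_cases hx : p x
    · exact Or.inr (ofSubtype_apply_of_not_mem _ (not_not.2 hx))
    · exact Or.inl (ofSubtype_apply_of_not_mem _ hx)
  rw [← cycleType_ofSubtype, ← cycleType_ofSubtype, ← hd.cycleType_mul]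
  congr 1
  ext x
  rw [mul_apply]
  by_cases hx : p x
  · rw [ofSubtype_apply_of_not_mem (p := fun x => ¬ p x) _ (not_not.2 hx),
      ofSubtype_apply_of_mem _ hx]
    rfl
  · rw [ofSubtype_apply_of_mem (p := fun x => ¬ p x) _ hx, ofSubtype_apply_of_not_mem]
    · rfl
    · simpa [h] using hx

/-- If conjugate permutations agree on an invariant set, then their restrictions to the complement
have the same cycle type, so a permutation that fixes the set pointwise conjugates one to the
other. -/
theorem exists_conj_of_isConj_of_eqOn {σ σ' : Perm α} (hc : IsConj σ σ') (p : α → Prop)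
    [DecidablePred p] (h : ∀ x, p (σ x) ↔ p x) (hp : ∀ x, p x → σ' x = σ x) :
    ∃ ρ : Perm α, ρ * σ * ρ⁻¹ = σ' ∧ ∀ x, p x → ρ x = x := by
  have h' : ∀ x, p (σ' x) ↔ p x := by
    intro x
    constructor
    · intro hx
      have h1 : p (σ⁻¹ (σ' x)) := by rw [← h]; simpa using hx
      have h2 : σ' (σ⁻¹ (σ' x)) = σ' x := by rw [hp _ h1]; simp
      rwa [← σ'.injective h2]
    · intro hx
      rw [hp x hx, h]
      exact hx
  have e1 : σ.subtypePerm h = σ'.subtypePerm h' := by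
    ext x
    simp [hp x x.2]
  have hcc := isConj_iff_cycleType_eq.1 hc
  rw [cycleType_eq_add_subtypePerm σ p h, cycleType_eq_add_subtypePerm σ' p h', e1,
    add_right_inj] at hcc
  obtain ⟨τ, hτ⟩ := isConj_iff.1 (isConj_iff_cycleType_eq.2 hcc)
  refine ⟨ofSubtype τ, ?_, fun x hx => ofSubtype_apply_of_not_mem _ (not_not.2 hx)⟩
  rw [mul_inv_eq_iff_eq_mul] at hτ ⊢
  ext x
  rw [mul_apply, mul_apply]
  by_cases hx : p x
  · rw [ofSubtype_apply_of_not_mem (p := fun x => ¬ p x) _ (not_not.2 hx),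
      ofSubtype_apply_of_not_mem (p := fun x => ¬ p x) _ (not_not.2 ((h x).2 hx)), hp x hx]
  · rw [ofSubtype_apply_of_mem (p := fun x => ¬ p x) _ hx,
      ofSubtype_apply_of_mem (p := fun x => ¬ p x) _ ((not_congr (h x)).2 hx)]
    exact congrArg Subtype.val (Perm.congr_fun hτ ⟨x, hx⟩)

theorem exists_conj_card_support_le {σ σ' : Perm α} (hc : IsConj σ σ') {N : ℕ} (hN : 0 < N) :
    ∃ ρ : Perm α, ρ * σ * ρ⁻¹ = σ' ∧
      ρ.support.card ≤ (σ ^ N).support.card + N * (σ⁻¹ * σ').support.card := by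
  classical
  -- The union of the `σ`-orbits of size dividing `N` on which `σ'` agrees with `σ`.
  let p (x : α) : Prop := (σ ^ N) x = x ∧ ∀ k : ℕ, σ' ((σ ^ k) x) = σ ((σ ^ k) x)
  have hs (k : ℕ) (x : α) : (σ ^ k) (σ x) = (σ ^ (k + 1)) x := by rw [pow_succ, mul_apply]
  have hp (x : α) : p (σ x) ↔ p x := by
    have h0 : (σ ^ N) (σ x) = σ x ↔ (σ ^ N) x = x := by
      rw [hs, pow_succ', mul_apply, σ.apply_eq_iff_eq]
    constructor
    · rintro ⟨h1, h2⟩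
      have h3 := h0.1 h1
      refine ⟨h3, fun k => ?_⟩
      have h4 : (σ ^ k) x = (σ ^ (k + (N - 1))) (σ x) := by
        rw [hs, show k + (N - 1) + 1 = k + N by omega, pow_add, mul_apply, h3]
      rw [h4]
      exact h2 _
    · rintro ⟨h1, h2⟩
      exact ⟨h0.2 h1, fun k => by rw [hs]; exact h2 _⟩
  obtain ⟨ρ, hρ, hfix⟩ := exists_conj_of_isConj_of_eqOn hc p hp fun x hx => hx.2 0
  refine ⟨ρ, hρ, ?_⟩
  have hsub : ρ.support ⊆ (σ ^ N).support ∪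
      (Finset.range N).biUnion fun k => (σ⁻¹ * σ').support.map (σ ^ k)⁻¹.toEmbedding := by
    intro x hx
    by_contra hcon
    rw [Finset.mem_union, not_or, notMem_support] at hcon
    obtain ⟨h1, h2⟩ := hcon
    refine mem_support.1 hx (hfix x ⟨h1, fun k => ?_⟩)
    have h3 : (σ ^ k) x = (σ ^ (k % N)) x := by
      conv_lhs => rw [← Nat.mod_add_div k N, pow_add, mul_apply, pow_mul]
      rw [pow_apply_eq_self_of_apply_eq_self h1]
    rw [h3]
    by_contra h4
    refine h2 (Finset.mem_biUnion.2 ⟨k % N, Finset.mem_range.2 (Nat.mod_lt _ hN),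
      Finset.mem_map.2 ⟨(σ ^ (k % N)) x, ?_, by simp⟩⟩)
    rw [mem_support, mul_apply, Ne, inv_eq_iff_eq]
    exact h4
  refine (Finset.card_le_card hsub).trans ((Finset.card_union_le _ _).trans ?_)
  gcongr
  refine Finset.card_biUnion_le.trans ?_
  simp

theorem hammingNorm_split {I : Type*} (U : Ultrafilter I) (n : I → ℕ) :
    TorsionCentralizersSplit U (fun i => hammingNorm (n i)) := by
  rintro g hg r rfl
  obtain ⟨N, hN, hpow⟩ := isOfFinOrder_iff_pow_eq_one.1 hg
  refine centralizer_eq_of_conj_bound U _ r N hpow (N + 1) fun i t => ?_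
  obtain ⟨ρ, hρ, hle⟩ := exists_conj_card_support_le (σ := r i) (σ' := t⁻¹ * r i * t)
    (isConj_iff.2 ⟨t⁻¹, by group⟩) hN
  refine ⟨ρ, hρ, ?_⟩
  change (ρ.support.card : ℝ) / n i ≤ (N + 1) * (((r i ^ N).support.card : ℝ) / n i +
    (((r i)⁻¹ * (t⁻¹ * r i * t)).support.card : ℝ) / n i)
  rw [← add_div, ← mul_div_assoc]
  gcongr
  have h : (ρ.support.card : ℝ) ≤ (r i ^ N).support.card +
    N * ((r i)⁻¹ * (t⁻¹ * r i * t)).support.card := by exact_mod_cast hle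
  refine h.trans ?_
  have h1 : (0 : ℝ) ≤ N * (r i ^ N).support.card := by positivity
  have h2 : (0 : ℝ) ≤ ((r i)⁻¹ * (t⁻¹ * r i * t)).support.card := by positivity
  linarith

end Permutations

/-! ### Cancellation for spaces with an endomorphism -/

section PolynomialModules

open Polynomial Module
open QuadraticMap (polar)

variable {K : Type*} [Field K] {W X Y : Type*} [AddCommGroup W] [Module K W]
  [AddCommGroup X] [Module K X] [AddCommGroup Y] [Module K Y]
  {a : End K W} {b : End K X} {b' : End K Y}

/-- An isomorphism that commutes with the endomorphisms is an isomorphism of modules over the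
polynomial ring. -/
theorem exists_linearEquiv_aeval_prod (e : (W × Y) ≃ₗ[K] (W × X))
    (he : ∀ p, e (a p.1, b' p.2) = (a (e p).1, b (e p).2)) :
    ∃ f : (AEval' a × AEval' b') ≃ₗ[K[X]] (AEval' a × AEval' b),
      ∀ p : W × Y, f (AEval'.of a p.1, AEval'.of b' p.2) =
        (AEval'.of a (e p).1, AEval'.of b (e p).2) := by
  let f₁ : AEval' (a.prodMap b') ≃ₗ[K[X]] (AEval' a × AEval' b') :=
    LinearEquiv.ofAEval _ ((AEval'.of a).prodCongr (AEval'.of b')) fun p => by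
      ext <;> simp [AEval'.X_smul_of]
  let f₂ : AEval' (a.prodMap b') ≃ₗ[K[X]] (AEval' a × AEval' b) :=
    LinearEquiv.ofAEval _ (e.trans ((AEval'.of a).prodCongr (AEval'.of b))) fun p => by
      have := he p
      ext <;> simp [AEval'.X_smul_of, this]
  refine ⟨f₁.symm.trans f₂, fun p => ?_⟩
  have h1 : f₁ (AEval'.of _ p) = (AEval'.of a p.1, AEval'.of b' p.2) := rfl
  rw [← h1, LinearEquiv.trans_apply, LinearEquiv.symm_apply_apply]
  rfl

theorem exists_linearMap_of_aeval (f : AEval' b →ₗ[K[X]] AEval' b') :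
    ∃ φ : X →ₗ[K] Y, (∀ x, φ (b x) = b' (φ x)) ∧ ∀ x, AEval'.of b' (φ x) = f (AEval'.of b x) := by
  refine ⟨(AEval'.of b').symm.toLinearMap ∘ₗ f.restrictScalars K ∘ₗ (AEval'.of b).toLinearMap,
    fun x => ?_, fun x => ?_⟩
  · apply (AEval'.of b').injective
    simp only [LinearMap.comp_apply, LinearEquiv.coe_coe, LinearMap.restrictScalars_apply,
      LinearEquiv.apply_symm_apply]
    rw [← AEval'.X_smul_of, map_smul, ← AEval'.X_smul_of, LinearEquiv.apply_symm_apply]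
  · simp

variable [Finite W] [Finite X] [Finite Y]

/-- Equivariant form of `nonempty_linearEquiv_of_prod`. -/
theorem exists_commuting_equiv_of_prod (e : (W × Y) ≃ₗ[K] (W × X))
    (he : ∀ p, e (a p.1, b' p.2) = (a (e p).1, b (e p).2)) :
    ∃ φ : X ≃ₗ[K] Y, ∀ x, φ (b x) = b' (φ x) := by
  have : Finite (AEval' a) := ‹Finite W›
  have : Finite (AEval' b) := ‹Finite X›
  have : Finite (AEval' b') := ‹Finite Y›
  obtain ⟨f, -⟩ := exists_linearEquiv_aeval_prod e he
  obtain ⟨f'⟩ := nonempty_linearEquiv_of_prod f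
  obtain ⟨φ, hφ, hf⟩ := exists_linearMap_of_aeval (f' : AEval' b →ₗ[K[X]] AEval' b')
  have hb : Function.Bijective φ := by
    have : ⇑φ = (AEval'.of b').symm ∘ f' ∘ AEval'.of b := by
      funext x
      simpa using congrArg (AEval'.of b').symm (hf x)
    rw [this]
    exact (AEval'.of b').symm.bijective.comp (f'.bijective.comp (AEval'.of b).bijective)
  exact ⟨LinearEquiv.ofBijective φ hb, hφ⟩

/-- Equivariant form of `exists_isometry_of_prod_isometry`. -/
theorem exists_commuting_isometry_of_prod [Finite K] (e : (W × Y) ≃ₗ[K] (W × X))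
    (he : ∀ p, e (a p.1, b' p.2) = (a (e p).1, b (e p).2))
    (DW : W × W → K) (DX : X × X → K) (DY : Y × Y → K)
    (hD : ∀ p q : W × Y, DW ((e p).1, (e q).1) + DX ((e p).2, (e q).2) =
      DW (p.1, q.1) + DY (p.2, q.2))
    (hadd : ∀ x y z, polar DW (x + y) z = polar DW x z + polar DW y z)
    (T : W →ₗ[K] W) (hTa : ∀ w, T (a w) = a (T w)) (hT : ∀ p, DW p = polar DW (T p.1, T p.2) p) :
    ∃ φ : X →ₗ[K] Y, (∀ x, φ (b x) = b' (φ x)) ∧ ∀ s t, DY (φ s, φ t) = DX (s, t) := by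
  have : Finite (AEval' a) := ‹Finite W›
  have : Finite (AEval' b) := ‹Finite X›
  have : Finite (AEval' b') := ‹Finite Y›
  obtain ⟨f, hf⟩ := exists_linearEquiv_aeval_prod e he
  let T' : AEval' a →ₗ[K[X]] AEval' a :=
    LinearMap.ofAEval a ((AEval'.of a).toLinearMap ∘ₗ T) fun w => by
      simp [AEval'.X_smul_of, hTa]
  obtain ⟨f', hf'⟩ := exists_isometry_of_prod_isometry (P := K) f
    (fun p => DW ((AEval'.of a).symm p.1, (AEval'.of a).symm p.2))
    (fun p => DX ((AEval'.of b).symm p.1, (AEval'.of b).symm p.2))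
    (fun p => DY ((AEval'.of b').symm p.1, (AEval'.of b').symm p.2))
    (fun p q => by
      have h1 := hf ((AEval'.of a).symm p.1, (AEval'.of b').symm p.2)
      have h2 := hf ((AEval'.of a).symm q.1, (AEval'.of b').symm q.2)
      simp only [LinearEquiv.apply_symm_apply, Prod.mk.eta] at h1 h2
      rw [h1, h2]
      simp only [LinearEquiv.symm_apply_apply]
      exact hD _ _)
    (fun x y z => hadd ((AEval'.of a).symm x.1, (AEval'.of a).symm x.2)
      ((AEval'.of a).symm y.1, (AEval'.of a).symm y.2)
      ((AEval'.of a).symm z.1, (AEval'.of a).symm z.2))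
    T' (fun p => hT ((AEval'.of a).symm p.1, (AEval'.of a).symm p.2))
  obtain ⟨φ, hφ, hf⟩ := exists_linearMap_of_aeval f'
  refine ⟨φ, hφ, fun s t => ?_⟩
  have := hf' (AEval'.of b s) (AEval'.of b t)
  simpa [← hf] using this

end PolynomialModules

/-! ### Conjugating endomorphisms that agree on a subspace -/

section Gluing

open Module

variable {K : Type*} [Field K] {V : Type*} [AddCommGroup V] [Module K V]

theorem prodEquivOfIsCompl_restrict {f : End K V} {W X : Submodule K V} (h : IsCompl W X)
    (hW : W ∈ f.invtSubmodule) (hX : X ∈ f.invtSubmodule) (p : W × X) :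
    W.prodEquivOfIsCompl X h (f.restrict hW p.1, f.restrict hX p.2) =
      f (W.prodEquivOfIsCompl X h p) := by
  simp only [Submodule.coe_prodEquivOfIsCompl', map_add]
  rfl

/-- The map that is the identity on `W` and `φ` on the complement `X`. -/
theorem exists_equiv_conj_of_isCompl {g g' : End K V} {W X Y : Submodule K V} (hX : IsCompl W X)
    (hY : IsCompl W Y) (hWi : W ∈ g.invtSubmodule) (hW : ∀ w ∈ W, g' w = g w)
    (φ : X ≃ₗ[K] Y) (hXi : X ∈ g.invtSubmodule)
    (hφ : ∀ x : X, (φ ⟨g x, hXi x.2⟩ : V) = g' (φ x)) :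
    ∃ ρ : V ≃ₗ[K] V, (∀ v, ρ (g v) = g' (ρ v)) ∧ ∀ (w : W) (x : X), ρ (w + x) = w + φ x := by
  let ρ : V ≃ₗ[K] V := (W.prodEquivOfIsCompl X hX).symm.trans
    (((LinearEquiv.refl K W).prodCongr φ).trans (W.prodEquivOfIsCompl Y hY))
  have hρ (w : W) (x : X) : ρ (w + x) = w + φ x := by
    have h : (w + x : V) = W.prodEquivOfIsCompl X hX (w, x) := by simp
    rw [h]
    simp [ρ, -Submodule.coe_prodEquivOfIsCompl]
  refine ⟨ρ, fun v => ?_, hρ⟩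
  obtain ⟨⟨w, x⟩, rfl⟩ := (W.prodEquivOfIsCompl X hX).surjective v
  have h1 := hρ ⟨g w, hWi w.2⟩ ⟨g x, hXi x.2⟩
  rw [hφ] at h1
  simp only [Submodule.coe_prodEquivOfIsCompl']
  rw [map_add, hρ, map_add, map_add, hW w w.2, ← map_add]
  exact h1

/-- If `g` is semisimple and `g'` is conjugate to `g` and agrees with it on an invariant subspace
`W`, then a linear automorphism that is the identity on `W` conjugates `g` to `g'`: invariant
complements of `W` for `g` and `g'` are isomorphic by cancellation. -/
theorem exists_linearEquiv_conj_of_eqOn [Finite V] {g g' : End K V} (hg : g.IsSemisimple)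
    (t : V ≃ₗ[K] V) (ht : ∀ v, t (g' v) = g (t v)) {W : Submodule K V}
    (hWi : W ∈ g.invtSubmodule) (hW : ∀ w ∈ W, g' w = g w) :
    ∃ ρ : V ≃ₗ[K] V, (∀ v, ρ (g v) = g' (ρ v)) ∧ ∀ w ∈ W, ρ w = w := by
  have hg' : g'.IsSemisimple :=
    (LinearEquiv.isSemisimple_iff g' g t (LinearMap.ext ht)).2 hg
  have hWi' : W ∈ g'.invtSubmodule := fun w hw => by
    rw [Submodule.mem_comap, hW w hw]
    exact hWi hw
  obtain ⟨X, hXi, hX⟩ := End.isSemisimple_iff.1 hg W hWi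
  obtain ⟨Y, hYi, hY⟩ := End.isSemisimple_iff.1 hg' W hWi'
  have hres : g'.restrict hWi' = g.restrict hWi :=
    LinearMap.ext fun w => Subtype.ext (hW w w.2)
  obtain ⟨φ, hφ⟩ := exists_commuting_equiv_of_prod (a := g.restrict hWi) (b := g.restrict hXi)
    (b' := g'.restrict hYi)
    ((W.prodEquivOfIsCompl Y hY).trans (t.trans (W.prodEquivOfIsCompl X hX).symm)) fun p => by
      simp only [LinearEquiv.trans_apply]
      rw [LinearEquiv.symm_apply_eq, prodEquivOfIsCompl_restrict, ← hres,
        prodEquivOfIsCompl_restrict, ht, LinearEquiv.apply_symm_apply]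
  obtain ⟨ρ, hρ, hρ'⟩ := exists_equiv_conj_of_isCompl hX hY hWi hW φ hXi
    fun x => congrArg Subtype.val (hφ x)
  exact ⟨ρ, hρ, fun w hw => by simpa using hρ' ⟨w, hw⟩ 0⟩

end Gluing

/-! ### Conjugating isometries that agree on a subspace -/

section Forms

open Module
open QuadraticMap (polar)

variable {K : Type*} [Field K] {V : Type*} [AddCommGroup V] [Module K V] {s : K →+* K}

/-- A function `D` on pairs of vectors whose isometries are to be studied, and a reflexive
sesquilinear form `B` without radical, which defines orthogonality. The function `D` is quadratic,
its polar form vanishes on orthogonal pairs and determines `B`. The two examples are `D (v, w) = B v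
w` and `D (v, w) = Q v` with `B` the polar form of the quadratic form `Q`; `D` takes two arguments
so that both are covered. -/
structure IsFormPair (B : V →ₛₗ[s] V →ₗ[K] K) (D : V × V → K) : Prop where
  refl : B.IsRefl
  separating : B.SeparatingLeft
  polar_add : ∀ p q r, polar D (p + q) r = polar D p r + polar D q r
  polar_eq_zero : ∀ p q : V × V, B p.1 q.1 = 0 → B p.1 q.2 = 0 → B q.1 p.2 = 0 → polar D p q = 0
  polar_diag : ∀ x y, polar D (x, x) (y, 0) = B y x

theorem surjOn_of_invtSubmodule [FiniteDimensional K V] {g : End K V} (hg : Function.Injective g)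
    {W : Submodule K V} (hW : W ∈ g.invtSubmodule) {w : V} (hw : w ∈ W) : ∃ v ∈ W, g v = w := by
  have hinj : Function.Injective (g.restrict hW) := fun x y hxy =>
    Subtype.ext (hg (congrArg Subtype.val hxy))
  obtain ⟨v, hv⟩ := LinearMap.injective_iff_surjective.1 hinj ⟨w, hw⟩
  exact ⟨v, v.2, congrArg Subtype.val hv⟩

section Orthogonal

variable {B : V →ₛₗ[s] V →ₗ[K] K}

theorem orthogonalBilin_mem_invtSubmodule [FiniteDimensional K V] {g : End K V}
    (hg : Function.Injective g) (hB : ∀ x y, B (g x) (g y) = B x y) {W : Submodule K V}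
    (hW : W ∈ g.invtSubmodule) : W.orthogonalBilin B ∈ g.invtSubmodule := by
  intro v hv w hw
  obtain ⟨w', hw', rfl⟩ := surjOn_of_invtSubmodule hg hW hw
  exact (hB w' v).trans (hv w' hw')

variable [Finite K] [FiniteDimensional K V]

/-- Over a finite field, dimensions of subspaces that correspond under a semilinear map are compared
by counting elements. -/
theorem finrank_add_finrank_orthogonalBilin_le (hrefl : B.IsRefl) (hsep : B.SeparatingLeft)
    (W : Submodule K V) : finrank K W + finrank K (W.orthogonalBilin B) ≤ finrank K V := by
  have : Finite V := Module.finite_of_finite K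
  have : Finite (Dual K V) := Module.finite_of_finite K
  rw [← Subspace.finrank_add_finrank_dualAnnihilator_eq W]
  gcongr
  have hcard := Nat.card_le_card_of_injective
    (fun v : W.orthogonalBilin B => (⟨B v, (Submodule.mem_dualAnnihilator _).2
      fun w hw => hrefl _ _ (v.2 w hw)⟩ : W.dualAnnihilator)) fun x y hxy => by
        have h : B (x : V) = B y := congrArg Subtype.val hxy
        refine Subtype.ext (sub_eq_zero.1 (hsep _ fun z => ?_))
        rw [map_sub, h, sub_self, LinearMap.zero_apply]
  rw [Module.natCard_eq_pow_finrank (K := K) (V := W.orthogonalBilin B),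
    Module.natCard_eq_pow_finrank (K := K) (V := W.dualAnnihilator)] at hcard
  exact (Nat.pow_le_pow_iff_right Finite.one_lt_card).1 hcard

/-- A subspace without radical is an orthogonal direct summand. The form embeds `W` semilinearly in
its dual space, which has the same finite number of elements. -/
theorem isCompl_orthogonalBilin (hrefl : B.IsRefl) {W : Submodule K V}
    (hW : Disjoint W (W.orthogonalBilin B)) : IsCompl W (W.orthogonalBilin B) := by
  refine ⟨hW, codisjoint_iff.2 (eq_top_iff.2 fun v _ => ?_)⟩
  have : Finite W := Module.finite_of_finite K
  have : Finite (Dual K W) := Module.finite_of_finite K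
  let F (v : V) : Dual K W := (B v).domRestrict W
  have hinj : Function.Injective fun w : W => F w := fun x y hxy => by
    have h (z : W) : B (x : V) z = B y z := LinearMap.congr_fun hxy z
    refine Subtype.ext (sub_eq_zero.1 (Submodule.disjoint_def.1 hW _ (x - y).2 fun z hz => ?_))
    refine hrefl _ _ ?_
    rw [map_sub, LinearMap.sub_apply, h ⟨z, hz⟩, sub_self]
  have hbij := (Nat.bijective_iff_injective_and_card _).2 ⟨hinj, by
    rw [Module.natCard_eq_pow_finrank (K := K) (V := W),
      Module.natCard_eq_pow_finrank (K := K) (V := Dual K W), Subspace.dual_finrank_eq]⟩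
  obtain ⟨w, hw⟩ := hbij.2 (F v)
  refine Submodule.mem_sup.2 ⟨w, w.2, v - w, fun z hz => hrefl _ _ ?_, add_sub_cancel _ _⟩
  have h : B (w : V) z = B v z := LinearMap.congr_fun hw ⟨z, hz⟩
  rw [map_sub, LinearMap.sub_apply, h, sub_self]

/-- An invariant subspace `W` contains an invariant subspace `W₁` without radical whose codimension
is at most twice that of `W`: an invariant complement in `W` of the radical of `W`, the dimension of
which is at most the codimension of `W`. -/
theorem exists_nondegenerate_invtSubmodule (hrefl : B.IsRefl) (hsep : B.SeparatingLeft)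
    {g : End K V} (hss : g.IsSemisimple) (hg : Function.Injective g)
    (hB : ∀ x y, B (g x) (g y) = B x y) {W : Submodule K V} (hW : W ∈ g.invtSubmodule) :
    ∃ W₁ ≤ W, W₁ ∈ g.invtSubmodule ∧ Disjoint W₁ (W₁.orthogonalBilin B) ∧
      2 * finrank K W ≤ finrank K W₁ + finrank K V := by
  have hRi : W ⊓ W.orthogonalBilin B ∈ g.invtSubmodule :=
    Sublattice.inf_mem hW (orthogonalBilin_mem_invtSubmodule hg hB hW)
  obtain ⟨C, hCi, hC⟩ := End.isSemisimple_iff.1 hss _ hRi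
  have hsup : (W ⊓ W.orthogonalBilin B) ⊔ (W ⊓ C) = W := by
    rw [inf_comm W C, ← sup_inf_assoc_of_le C inf_le_left, hC.sup_eq_top, top_inf_eq]
  refine ⟨W ⊓ C, inf_le_left, Sublattice.inf_mem hW hCi, ?_, ?_⟩
  · refine Submodule.disjoint_def.2 fun x hx hx' => ?_
    refine Submodule.disjoint_def.1 hC.disjoint x ⟨hx.1, fun w hw => ?_⟩ hx.2
    rw [← hsup] at hw
    obtain ⟨r, hr, c, hc, rfl⟩ := Submodule.mem_sup.1 hw
    rw [map_add, LinearMap.add_apply, hx' c hc, hrefl _ _ (hr.2 x hx.1), add_zero]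
  · have h1 := finrank_add_finrank_orthogonalBilin_le hrefl hsep W
    have h2 := Submodule.finrank_add_le_finrank_add_finrank (W ⊓ W.orthogonalBilin B) (W ⊓ C)
    rw [hsup] at h2
    have h3 := Submodule.finrank_mono (inf_le_right : W ⊓ W.orthogonalBilin B ≤ _)
    omega

end Orthogonal

variable {B : V →ₛₗ[s] V →ₗ[K] K} {D : V × V → K}

theorem polar_map_eq {f : V →ₗ[K] V} (hf : ∀ p : V × V, D (f p.1, f p.2) = D p) (p q : V × V) :
    polar D (f p.1, f p.2) (f q.1, f q.2) = polar D p q := by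
  simp only [polar]
  rw [← hf (p + q), ← hf p, ← hf q]
  simp

namespace IsFormPair

theorem map_zero (h : IsFormPair B D) : D 0 = 0 := by
  have h1 := h.polar_eq_zero 0 0 (by simp) (by simp) (by simp)
  simpa [polar] using h1

theorem apply_map (h : IsFormPair B D) {f : V →ₗ[K] V}
    (hf : ∀ p : V × V, D (f p.1, f p.2) = D p) (x y : V) : B (f x) (f y) = B x y := by
  rw [← h.polar_diag, ← h.polar_diag, ← polar_map_eq hf (y, y), _root_.map_zero]

theorem injective (h : IsFormPair B D) {f : V →ₗ[K] V} (hf : ∀ p : V × V, D (f p.1, f p.2) = D p) :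
    Function.Injective f := by
  refine (injective_iff_map_eq_zero f).2 fun x hx => h.separating x fun y => ?_
  rw [← h.apply_map hf, hx, _root_.map_zero, LinearMap.zero_apply]

theorem apply_add (h : IsFormPair B D) {p q : V × V} (h₁ : B p.1 q.1 = 0) (h₂ : B p.1 q.2 = 0)
    (h₃ : B q.1 p.2 = 0) :
    D (p + q) = D p + D q := by
  have := h.polar_eq_zero p q h₁ h₂ h₃
  rwa [polar, sub_sub, sub_eq_zero] at this

end IsFormPair

/-- If `g` is a semisimple isometry and `g'` is conjugate to `g` by an isometry and agrees with it
on an invariant subspace `W`, then `g` and `g'` are conjugate by an isometry that is the identity on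
a subspace of codimension at most twice that of `W`. Both act on the orthogonal complement `X` of a
nondegenerate part `W₁` of `W`, and Witt cancellation gives an isometry of `X` that conjugates one
action to the other. -/
theorem exists_isometry_conj_of_eqOn [Finite K] [FiniteDimensional K V] (h : IsFormPair B D)
    {g g' : End K V} (hgD : ∀ p : V × V, D (g p.1, g p.2) = D p) (hg : g.IsSemisimple)
    (T : V →ₗ[K] V) (hTg : ∀ v, T (g v) = g (T v)) (hT : ∀ p, D p = polar D (T p.1, T p.2) p)
    (t : V ≃ₗ[K] V) (htD : ∀ p : V × V, D (t p.1, t p.2) = D p) (ht : ∀ v, t (g' v) = g (t v))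
    {W : Submodule K V} (hWi : W ∈ g.invtSubmodule) (hWg : ∀ w ∈ W, g' w = g w) :
    ∃ ρ : V ≃ₗ[K] V, (∀ v, ρ (g v) = g' (ρ v)) ∧ (∀ p : V × V, D (ρ p.1, ρ p.2) = D p) ∧
      ∃ W₁ : Submodule K V, (∀ w ∈ W₁, ρ w = w) ∧
        2 * finrank K W ≤ finrank K W₁ + finrank K V := by
  have : Finite V := Module.finite_of_finite K
  have hg'D (p : V × V) : D (g' p.1, g' p.2) = D p := by
    rw [← htD, ht, ht, ← htD p]
    exact hgD (t p.1, t p.2)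
  have hinj := h.injective hgD
  obtain ⟨W₁, hle, hW₁, hdisj, hrank⟩ := exists_nondegenerate_invtSubmodule h.refl h.separating hg
    hinj (h.apply_map hgD) hWi
  have hW₁' : W₁ ∈ g'.invtSubmodule := fun w hw => by
    rw [Submodule.mem_comap, hWg w (hle hw)]
    exact hW₁ hw
  have hX := isCompl_orthogonalBilin h.refl hdisj
  have hXi := orthogonalBilin_mem_invtSubmodule hinj (h.apply_map hgD) hW₁
  have hXi' := orthogonalBilin_mem_invtSubmodule (h.injective hg'D) (h.apply_map hg'D) hW₁'
  set X := W₁.orthogonalBilin B with hXdef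
  have hres : g'.restrict hW₁' = g.restrict hW₁ :=
    LinearMap.ext fun w => Subtype.ext (hWg w (hle w.2))
  have horth {w x : V} (hw : w ∈ W₁) (hx : x ∈ X) : B w x = 0 := hx w hw
  have hsplit {w w' x x' : V} (hw : w ∈ W₁) (hw' : w' ∈ W₁) (hx : x ∈ X) (hx' : x' ∈ X) :
      D (w + x, w' + x') = D (w, w') + D (x, x') :=
    h.apply_add (p := (w, w')) (q := (x, x')) (horth hw hx) (horth hw hx')
      (h.refl _ _ (horth hw' hx))
  -- The orthogonal projection to `W₁`. It makes `T` act on `W₁`.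
  let pr : V →ₗ[K] W₁ := LinearMap.fst K W₁ X ∘ₗ (W₁.prodEquivOfIsCompl X hX).symm.toLinearMap
  have hpr (v : V) : v - pr v ∈ X := by
    obtain ⟨p, rfl⟩ := (W₁.prodEquivOfIsCompl X hX).surjective v
    simp [pr, -Submodule.coe_prodEquivOfIsCompl]
  have hprg (v : V) : pr (g v) = g.restrict hW₁ (pr v) := by
    obtain ⟨p, rfl⟩ := (W₁.prodEquivOfIsCompl X hX).surjective v
    rw [← prodEquivOfIsCompl_restrict hX hW₁ hXi]
    simp [pr, -Submodule.coe_prodEquivOfIsCompl]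
  obtain ⟨φ, hφ, hφD⟩ := exists_commuting_isometry_of_prod (a := g.restrict hW₁)
    (b := g.restrict hXi) (b' := g'.restrict hXi')
    ((W₁.prodEquivOfIsCompl X hX).trans (t.trans (W₁.prodEquivOfIsCompl X hX).symm))
    (fun p => by
      simp only [LinearEquiv.trans_apply]
      rw [LinearEquiv.symm_apply_eq, prodEquivOfIsCompl_restrict, ← hres,
        prodEquivOfIsCompl_restrict, ht, LinearEquiv.apply_symm_apply])
    (fun p => D (p.1, p.2)) (fun p => D (p.1, p.2)) (fun p => D (p.1, p.2))
    (fun p q => by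
      obtain ⟨⟨p₁, p₂⟩, hp⟩ := (W₁.prodEquivOfIsCompl X hX).surjective
        (t (W₁.prodEquivOfIsCompl X hX p))
      obtain ⟨⟨q₁, q₂⟩, hq⟩ := (W₁.prodEquivOfIsCompl X hX).surjective
        (t (W₁.prodEquivOfIsCompl X hX q))
      simp only [LinearEquiv.trans_apply]
      rw [← hp, ← hq, LinearEquiv.symm_apply_apply, LinearEquiv.symm_apply_apply]
      dsimp only
      rw [← hsplit p₁.2 q₁.2 p₂.2 q₂.2, ← hsplit p.1.2 q.1.2 p.2.2 q.2.2]
      rw [← htD (p.1 + p.2, q.1 + q.2)]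
      simpa using congrArg₂ (fun x y => D (x, y)) hp hq)
    (fun x y z => h.polar_add (x.1, x.2) (y.1, y.2) (z.1, z.2))
    (pr ∘ₗ T ∘ₗ W₁.subtype)
    (fun w => by
      change pr (T (g w)) = g.restrict hW₁ (pr (T w))
      rw [hTg, hprg])
    (fun p => by
      have h1 := hT (p.1, p.2)
      have h2 : polar D (T p.1 - pr (T p.1), T p.2 - pr (T p.2)) (p.1, p.2) = 0 :=
        h.polar_eq_zero _ _ (h.refl _ _ (horth p.1.2 (hpr _)))
          (h.refl _ _ (horth p.2.2 (hpr _))) (horth p.1.2 (hpr _))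
      have h3 := h.polar_add (pr (T p.1), pr (T p.2))
        (T p.1 - pr (T p.1), T p.2 - pr (T p.2)) (p.1, p.2)
      rw [h2, add_zero, Prod.mk_add_mk, add_sub_cancel, add_sub_cancel] at h3
      exact h1.trans h3)
  -- A form-preserving map out of the nondegenerate space `X` is injective.
  have hφinj : Function.Injective φ := by
    refine (injective_iff_map_eq_zero φ).2 fun x hx => Subtype.ext (h.separating x fun y => ?_)
    obtain ⟨w, hw, z, hz, rfl⟩ := Submodule.mem_sup.1 (hX.sup_eq_top ▸ Submodule.mem_top : y ∈ _)
    rw [map_add, h.refl _ _ (horth hw x.2), zero_add, ← h.polar_diag]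
    have h1 := hφD (⟨z, hz⟩ + x) ⟨z, hz⟩
    have h2 := hφD x 0
    rw [map_add, hx, add_zero, hφD] at h1
    rw [hx, _root_.map_zero] at h2
    have h3 : D ((0 : X), (0 : X)) = 0 := h.map_zero
    rw [h3] at h2
    simp only [polar, Prod.mk_add_mk, add_zero]
    simp only [Submodule.coe_add, Submodule.coe_zero] at h1 h2
    rw [← h1, ← h2, sub_self, sub_zero]
  obtain ⟨ρ, hρ, hρ'⟩ := exists_equiv_conj_of_isCompl hX hX hW₁ (fun w hw => hWg w (hle hw))
    (LinearEquiv.ofInjectiveEndo φ hφinj) hXi fun x => congrArg Subtype.val (hφ x)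
  refine ⟨ρ, hρ, fun p => ?_, W₁, fun w hw => by simpa using hρ' ⟨w, hw⟩ 0, hrank⟩
  obtain ⟨⟨p₁, p₂⟩, hp⟩ := (W₁.prodEquivOfIsCompl X hX).surjective p.1
  obtain ⟨⟨q₁, q₂⟩, hq⟩ := (W₁.prodEquivOfIsCompl X hX).surjective p.2
  obtain ⟨x, y⟩ := p
  simp only [Submodule.coe_prodEquivOfIsCompl'] at hp hq
  dsimp only
  rw [← hp, ← hq, hρ', hρ', hsplit p₁.2 q₁.2 (Subtype.mem _) (Subtype.mem _),
    hsplit p₁.2 q₁.2 p₂.2 q₂.2]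
  congr 1
  exact hφD p₂ q₂

end Forms

/-! ### Semisimple elements and averaging -/

section Semisimple

open Module Polynomial
open QuadraticMap (polar)

variable {K : Type*} [Field K] {V : Type*} [AddCommGroup V] [Module K V]

theorem natCast_ne_zero_of_coprime {m q : ℕ} (hq : (q : K) = 0) (hm : m.Coprime q) :
    (m : K) ≠ 0 := by
  intro h
  have h1 := congrArg (fun x : ℤ => (x : K)) (Nat.gcd_eq_gcd_ab m q)
  simp [hm.gcd_eq_one, h, hq] at h1

theorem isSemisimple_of_pow_eq_one {g : End K V} {m : ℕ} (hm : (m : K) ≠ 0) (hg : g ^ m = 1) :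
    g.IsSemisimple :=
  End.isSemisimple_of_squarefree_aeval_eq_zero (p := X ^ m - 1)
    (X_pow_sub_one_separable_iff.2 hm).squarefree (by simp [hg])

/-- The condition on `T` is affine and invariant under conjugation by isometries, so averaging over
the powers of `g` makes `T` commute with `g`; the order of `g` is invertible in `K`. -/
theorem exists_commuting_polar_eq {s : K →+* K} {B : V →ₛₗ[s] V →ₗ[K] K} {D : V × V → K}
    (h : IsFormPair B D) (g : (End K V)ˣ) (hg : ∀ p : V × V, D (g.val p.1, g.val p.2) = D p) {q : ℕ}
    (hq : (q : K) = 0) (hm : (orderOf g).Coprime q) (T : V →ₗ[K] V)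
    (hT : ∀ p, D p = polar D (T p.1, T p.2) p) :
    ∃ T' : V →ₗ[K] V, (∀ v, T' (g.val v) = g.val (T' v)) ∧
      ∀ p, D p = polar D (T' p.1, T' p.2) p := by
  let F (k : ℕ) : End K V := ((g⁻¹) ^ k).val * T * (g ^ k).val
  have hpow (k : ℕ) (p : V × V) : D ((g ^ k).val p.1, (g ^ k).val p.2) = D p := by
    induction k with
    | zero => simp
    | succ k ih =>
      rw [pow_succ', Units.val_mul, Module.End.mul_apply, Module.End.mul_apply, ← ih]
      exact hg ((g ^ k).val p.1, (g ^ k).val p.2)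
  have hF (k : ℕ) (p : V × V) : polar D (F k p.1, F k p.2) p = D p := by
    rw [← polar_map_eq (hpow k), ← hpow k p, hT]
    have (v : V) : (g ^ k).val (F k v) = T ((g ^ k).val v) := by
      simp only [F, ← Module.End.mul_apply, ← mul_assoc, ← Units.val_mul]
      simp
    rw [this, this]
  let S : End K V := ∑ k ∈ Finset.range (orderOf g), F k
  have hS : g.val * S = S * g.val := by
    have h1 : (g⁻¹).val * S * g.val = S := by
      have h2 : F (orderOf g) = F 0 := by
        simp only [F, inv_pow, pow_orderOf_eq_one, pow_zero]
      have h3 := (Finset.sum_range_succ F (orderOf g)).symm.trans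
        (Finset.sum_range_succ' F (orderOf g))
      rw [h2, add_right_cancel_iff] at h3
      rw [Finset.mul_sum, Finset.sum_mul]
      refine Eq.trans (Finset.sum_congr rfl fun k _ => ?_) h3.symm
      simp only [F, pow_succ' (g⁻¹), pow_succ g, Units.val_mul, mul_assoc]
    rw [mul_assoc, Units.inv_mul_eq_iff_eq_mul] at h1
    exact h1.symm
  -- An integer inverse of the order of `g` in `K`; `polar D` need only be additive.
  let c : ℤ := (orderOf g).gcdA q
  have hc : (c : K) * (orderOf g : ℕ) = 1 := by
    have h1 := congrArg (fun x : ℤ => (x : K)) (Nat.gcd_eq_gcd_ab (orderOf g) q)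
    simpa [hm.gcd_eq_one, hq, mul_comm, c, eq_comm] using h1
  refine ⟨c • S, fun v => ?_, fun p => ?_⟩
  · have := LinearMap.congr_fun hS v
    simp only [Module.End.mul_apply] at this
    simp [this]
  · let L : V × V →+ K := AddMonoidHom.mk' (fun x => polar D x p) fun x y => h.polar_add x y p
    have h1 : ((c • S) p.1, (c • S) p.2) =
        c • ∑ k ∈ Finset.range (orderOf g), ((F k p.1, F k p.2) : V × V) := by
      ext <;> simp [S, Prod.fst_sum, Prod.snd_sum, Finset.smul_sum]
    change D p = L ((c • S) p.1, (c • S) p.2)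
    rw [h1, map_zsmul, map_sum]
    have h2 (k : ℕ) : L (F k p.1, F k p.2) = D p := hF k p
    simp only [h2, Finset.sum_const, Finset.card_range]
    rw [nsmul_eq_mul, zsmul_eq_mul, ← mul_assoc, hc, one_mul]

end Semisimple

/-! ### The subspace on which two endomorphisms agree -/

section Agreement

open Module

variable {K : Type*} [Field K] {V : Type*} [AddCommGroup V] [Module K V]

/-- The vectors `v` with `g ^ N v = v` such that `g'` agrees with `g` on the whole `g`-orbit of `v`.
-/
def agreementSubmodule (g g' : End K V) (N : ℕ) : Submodule K V :=
  LinearMap.ker (1 - g ^ N) ⊓ ⨅ k : ℕ, LinearMap.ker ((g - g') * g ^ k)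

theorem mem_agreementSubmodule {g g' : End K V} {N : ℕ} {v : V} :
    v ∈ agreementSubmodule g g' N ↔
      (g ^ N) v = v ∧ ∀ k : ℕ, g' ((g ^ k) v) = g ((g ^ k) v) := by
  simp [agreementSubmodule, sub_eq_zero, @eq_comm _ v, @eq_comm _ (g' _)]

theorem agreementSubmodule_mem_invtSubmodule (g g' : End K V) (N : ℕ) :
    agreementSubmodule g g' N ∈ g.invtSubmodule := by
  intro v hv
  obtain ⟨h1, h2⟩ := mem_agreementSubmodule.1 hv
  have hs (k : ℕ) : (g ^ k) (g v) = (g ^ (k + 1)) v := by rw [pow_succ, End.mul_apply]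
  refine mem_agreementSubmodule.2 ⟨?_, fun k => ?_⟩
  · rw [hs, pow_succ', End.mul_apply, h1]
  · rw [hs]
    exact h2 _

theorem finrank_le_finrank_inf_ker [FiniteDimensional K V] (A : Submodule K V) (L : End K V) :
    finrank K A ≤ finrank K ↑(A ⊓ LinearMap.ker L) + finrank K (LinearMap.range L) := by
  have h1 := Submodule.finrank_sup_add_finrank_inf_eq A (LinearMap.ker L)
  have h2 := LinearMap.finrank_range_add_finrank_ker L
  have h3 := Submodule.finrank_le (A ⊔ LinearMap.ker L)
  omega

theorem finrank_le_finrank_agreementSubmodule [FiniteDimensional K V] (g g' : End K V) {N : ℕ}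
    (hN : 0 < N) : finrank K V ≤ finrank K (agreementSubmodule g g' N) +
      (finrank K (LinearMap.range (1 - g ^ N)) + N * finrank K (LinearMap.range (g - g'))) := by
  have key (m : ℕ) : finrank K V ≤
      finrank K ↑(LinearMap.ker (1 - g ^ N) ⊓
        ⨅ k ∈ Finset.range m, LinearMap.ker ((g - g') * g ^ k)) +
      (finrank K (LinearMap.range (1 - g ^ N)) + m * finrank K (LinearMap.range (g - g'))) := by
    induction m with
    | zero =>
      have := finrank_le_finrank_inf_ker ⊤ (1 - g ^ N)
      rw [finrank_top, top_inf_eq] at this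
      have h0 : ⨅ k ∈ Finset.range 0, LinearMap.ker ((g - g') * g ^ k) = ⊤ := by simp
      rwa [h0, inf_top_eq, zero_mul, add_zero]
    | succ m ih =>
      have h1 := finrank_le_finrank_inf_ker (LinearMap.ker (1 - g ^ N) ⊓
        ⨅ k ∈ Finset.range m, LinearMap.ker ((g - g') * g ^ k)) ((g - g') * g ^ m)
      have h2 : finrank K (LinearMap.range ((g - g') * g ^ m)) ≤
          finrank K (LinearMap.range (g - g')) :=
        Submodule.finrank_mono (LinearMap.range_comp_le_range _ _)
      have h3 : LinearMap.ker (1 - g ^ N) ⊓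
          ⨅ k ∈ Finset.range (m + 1), LinearMap.ker ((g - g') * g ^ k) =
          (LinearMap.ker (1 - g ^ N) ⊓
            ⨅ k ∈ Finset.range m, LinearMap.ker ((g - g') * g ^ k)) ⊓
              LinearMap.ker ((g - g') * g ^ m) := by
        rw [Finset.range_add_one, Finset.iInf_insert, inf_comm (LinearMap.ker ((g - g') * g ^ m)),
          inf_assoc]
      rw [h3, Nat.succ_mul]
      omega
  refine (key N).trans (Nat.add_le_add_right (Submodule.finrank_mono ?_) _)
  intro v hv
  obtain ⟨h1, h2⟩ := Submodule.mem_inf.1 hv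
  have h1' : (g ^ N) v = v := by simpa [sub_eq_zero, @eq_comm _ v] using h1
  refine mem_agreementSubmodule.2 ⟨h1', fun k => ?_⟩
  have h3 : (g ^ k) v = (g ^ (k % N)) v := by
    have h4 (j : ℕ) : ((g ^ N) ^ j) v = v := by
      induction j with
      | zero => rfl
      | succ j ih => rw [pow_succ, End.mul_apply, h1', ih]
    conv_lhs => rw [← Nat.mod_add_div k N, pow_add, End.mul_apply, pow_mul, h4]
  have h5 := (Submodule.mem_iInf _).1 ((Submodule.mem_iInf _).1 h2 (k % N))
    (Finset.mem_range.2 (Nat.mod_lt _ hN))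
  rw [h3]
  have h6 : g ((g ^ (k % N)) v) - g' ((g ^ (k % N)) v) = 0 := h5
  exact (sub_eq_zero.1 h6).symm

theorem finrank_range_one_sub_le [FiniteDimensional K V] {ρ : End K V} {W : Submodule K V}
    (h : ∀ w ∈ W, ρ w = w) : finrank K (LinearMap.range (1 - ρ)) + finrank K W ≤ finrank K V := by
  rw [← LinearMap.finrank_range_add_finrank_ker (1 - ρ : End K V)]
  refine Nat.add_le_add_left (Submodule.finrank_mono ?_) _
  intro w hw
  simp [h w hw]

end Agreement

/-! ### Alternating, quadratic and Hermitian forms -/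

section FormPairs

open Module
open QuadraticMap (polar)

variable {K : Type*} [Field K] {V : Type*} [AddCommGroup V] [Module K V] {s : K →+* K}

theorem polar_sesquilinear (f : V →ₛₗ[s] V →ₗ[K] K) (p q : V × V) :
    polar (fun p : V × V => f p.1 p.2) p q = f p.1 q.2 + f q.1 p.2 := by
  simp [polar]
  ring

theorem isFormPair_sesquilinear {f : V →ₛₗ[s] V →ₗ[K] K} (hr : f.IsRefl)
    (hf : f.SeparatingLeft) : IsFormPair f fun p => f p.1 p.2 where
  refl := hr
  separating := hf
  polar_add p q r := by
    simp only [polar_sesquilinear]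
    simp
    ring
  polar_eq_zero p q _ h₂ h₃ := by rw [polar_sesquilinear, h₂, h₃, add_zero]
  polar_diag x y := by simp [polar_sesquilinear]

theorem isFormPair_quadratic {Q : QuadraticForm K V} (hQ : Q.polarBilin.SeparatingLeft) :
    IsFormPair Q.polarBilin fun p => Q p.1 where
  refl x y h := by
    rw [QuadraticMap.polarBilin_apply_apply] at h ⊢
    rwa [QuadraticMap.polar_comm]
  separating := hQ
  polar_add p q r := QuadraticMap.polar_add_left Q p.1 q.1 r.1
  polar_eq_zero p q h _ _ := h
  polar_diag x y := QuadraticMap.polar_comm Q x y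

/-- The scalar `c` serves as `T`. -/
theorem exists_polar_eq_sesquilinear (f : V →ₛₗ[s] V →ₗ[K] K) {c : K} (hc : s c + c = 1) :
    ∃ T : V →ₗ[K] V, ∀ p : V × V,
      f p.1 p.2 = polar (fun p : V × V => f p.1 p.2) (T p.1, T p.2) p := by
  refine ⟨c • LinearMap.id, fun p => ?_⟩
  rw [polar_sesquilinear]
  simp [← add_mul, hc]

variable [FiniteDimensional K V]

theorem exists_apply_eq {B : V →ₗ[K] V →ₗ[K] K} (hB : B.SeparatingLeft) (A : V →ₗ[K] V →ₗ[K] K) :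
    ∃ T : V →ₗ[K] V, ∀ x y, B (T x) y = A x y := by
  have hinj : Function.Injective B :=
    LinearMap.ker_eq_bot.1 (LinearMap.separatingLeft_iff_ker_eq_bot.1 hB)
  let e : V ≃ₗ[K] Dual K V :=
    LinearEquiv.ofInjectiveOfFinrankEq B hinj Subspace.dual_finrank_eq.symm
  refine ⟨e.symm.toLinearMap ∘ₗ A, fun x y => ?_⟩
  exact LinearMap.congr_fun (e.apply_symm_apply (A x)) y

/-- A quadratic form is the diagonal `A v v` of a bilinear form `A`, and `A v w = B (T v) w`. -/
theorem exists_polar_eq_quadratic {Q : QuadraticForm K V} (hQ : Q.polarBilin.SeparatingLeft) :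
    ∃ T : V →ₗ[K] V, ∀ p : V × V,
      Q p.1 = polar (fun p : V × V => Q p.1) (T p.1, T p.2) p := by
  obtain ⟨A, hA⟩ := LinearMap.BilinMap.toQuadraticMap_surjective Q
  obtain ⟨T, hT⟩ := exists_apply_eq hQ A
  refine ⟨T, fun p => ?_⟩
  have h : Q.polarBilin (T p.1) p.1 = Q p.1 := by rw [hT, ← hA]; rfl
  exact h.symm

/-- The form with the strictly upper triangular part of the Gram matrix of `f`. -/
theorem exists_sub_flip_eq {n : ℕ} {f : Vec K n →ₗ[K] Vec K n →ₗ[K] K} (hf : f.IsAlt) :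
    ∃ A : Vec K n →ₗ[K] Vec K n →ₗ[K] K, ∀ x y, A x y - A y x = f x y := by
  let M : Matrix (Fin n) (Fin n) K := LinearMap.toMatrix₂' K f
  let M' : Matrix (Fin n) (Fin n) K := Matrix.of fun i j => if i < j then M i j else 0
  have hM : M' - M'.transpose = M := by
    ext i j
    have h1 (i j : Fin n) : M i j = f (Pi.single i 1) (Pi.single j 1) := rfl
    simp only [Matrix.sub_apply, Matrix.transpose_apply, M', Matrix.of_apply]
    rcases lt_trichotomy i j with h | h | h
    · simp [h, h.not_gt]
    · subst h
      simp [h1, hf.self_eq_zero]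
    · simp [h, h.not_gt, h1, hf.neg]
  refine ⟨Matrix.toLinearMap₂' K M', fun x y => ?_⟩
  have h2 : Matrix.toLinearMap₂' K M = f := by simp [M]
  rw [← h2, ← hM, map_sub, LinearMap.sub_apply, LinearMap.sub_apply]
  congr 1
  simp only [Matrix.toLinearMap₂'_apply']
  rw [Matrix.mulVec_transpose, dotProduct_comm x, Matrix.dotProduct_mulVec]

/-- An alternating form is `A v w - A w v` for a bilinear form `A`, and `A v w = f (T v) w`. -/
theorem exists_polar_eq_alternating {n : ℕ} {f : Vec K n →ₗ[K] Vec K n →ₗ[K] K} (hf : f.IsAlt)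
    (hs : f.SeparatingLeft) : ∃ T : Vec K n →ₗ[K] Vec K n, ∀ p : Vec K n × Vec K n,
      f p.1 p.2 = polar (fun p : Vec K n × Vec K n => f p.1 p.2) (T p.1, T p.2) p := by
  obtain ⟨A, hA⟩ := exists_sub_flip_eq hf
  obtain ⟨T, hT⟩ := exists_apply_eq hs A
  refine ⟨T, fun p => ?_⟩
  rw [polar_sesquilinear, hT, ← hf.neg (T p.2) p.1, hT, ← hA, sub_eq_add_neg]

/-- An element of trace `1`. -/
theorem exists_qFrob_add_self_eq_one (F E : Type*) [Field F] [Fintype F] [Field E] [Algebra F E]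
    (h : finrank F E = 2) : ∃ c : E, qFrob F E c + c = 1 := by
  have : FiniteDimensional F E := FiniteDimensional.of_finrank_pos (by omega)
  have : Finite E := Module.finite_of_finite F
  obtain ⟨c, hc⟩ := Algebra.trace_surjective F E 1
  refine ⟨c, ?_⟩
  have h1 := FiniteField.algebraMap_trace_eq_sum_pow F E c
  rw [hc, map_one, h, Finset.sum_range_succ, Finset.sum_range_one] at h1
  rw [h1]
  simp [add_comm]

end FormPairs

/-! ### Centralizers in the classical groups -/

section Splitting

open Module
open QuadraticMap (polar)

theorem rk_sub_le {K : Type*} [Field K] {n : ℕ} (a b : GLn K n) :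
    rk (a.val - b.val) ≤ rk (1 - (a⁻¹ * b).val) := by
  have h : a.val - b.val = a.val * (1 - (a⁻¹ * b).val) := by
    rw [mul_sub, mul_one, ← Units.val_mul, mul_inv_cancel_left]
  rw [h]
  exact rk_mul_le_right _ _

theorem mul_eq_mul_of_apply {K : Type*} [Field K] {n : ℕ} {ρ : Vec K n ≃ₗ[K] Vec K n}
    {a b : GLn K n} (h : ∀ v, ρ (a.val v) = b.val (ρ v)) :
    LinearMap.GeneralLinearGroup.ofLinearEquiv ρ * a *
      (LinearMap.GeneralLinearGroup.ofLinearEquiv ρ)⁻¹ = b := by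
  rw [mul_inv_eq_iff_eq_mul]
  exact Units.ext (LinearMap.ext h)

theorem conj_apply {K : Type*} [Field K] {n : ℕ} (t a : GLn K n) (v : Vec K n) :
    t.toLinearEquiv ((t⁻¹ * a * t).val v) = a.val (t.toLinearEquiv v) := by
  have h : t * (t⁻¹ * a * t) = a * t := by group
  exact LinearMap.congr_fun (congrArg Units.val h) v

/-- A rank estimate for `1 - ρ`, with the constant `C`, in terms of the normalized rank norms. -/
theorem rank_bound {K : Type*} [Field K] {n N C : ℕ} (a b ρ : GLn K n)
    (hρ : rk (1 - ρ.val) ≤ C * (rk (1 - a.val ^ N) + N * rk (a.val - b.val))) :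
    (rankNorm K n).toFun ρ ≤
      (C * (N + 1) : ℝ) * ((rankNorm K n).toFun (a ^ N) + (rankNorm K n).toFun (a⁻¹ * b)) := by
  change (rk (1 - ρ.val) : ℝ) / n ≤ (C * (N + 1) : ℝ) *
    ((rk (1 - a.val ^ N) : ℝ) / n + (rk (1 - (a⁻¹ * b).val) : ℝ) / n)
  rw [← add_div, ← mul_div_assoc]
  gcongr
  have h1 := hρ.trans (Nat.mul_le_mul_left C
    (Nat.add_le_add_left (Nat.mul_le_mul_left N (rk_sub_le a b)) _))
  have h2 : (rk (1 - ρ.val) : ℝ) ≤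
      C * (rk (1 - a.val ^ N) + N * rk (1 - (a⁻¹ * b).val)) := by exact_mod_cast h1
  refine h2.trans ?_
  rw [mul_assoc]
  have h3 : (0 : ℝ) ≤ N * rk (1 - a.val ^ N) := by positivity
  have h4 : (0 : ℝ) ≤ rk (1 - (a⁻¹ * b).val) := by positivity
  gcongr
  linarith

variable {I : Type*} (U : Ultrafilter I) (n : I → ℕ) {K : Type*} [Field K] [Finite K] {q : ℕ}

theorem rankNorm_split (hq : (q : K) = 0) :
    SemisimpleTorsionCentralizersSplit U (fun i => rankNorm K (n i)) q := by
  rintro g - hg r rfl hr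
  obtain ⟨N, hN, hpow⟩ := isOfFinOrder_iff_pow_eq_one.1 hg
  refine centralizer_eq_of_conj_bound U _ r N hpow ((1 : ℕ) * (N + 1)) fun i t => ?_
  have : Finite (Vec K (n i)) := Module.finite_of_finite K
  have hss : Module.End.IsSemisimple (r i).val :=
    isSemisimple_of_pow_eq_one (natCast_ne_zero_of_coprime hq (hr i)) (by
      rw [← Units.val_pow_eq_pow_val, pow_orderOf_eq_one, Units.val_one])
  obtain ⟨ρ, hρ, hfix⟩ := exists_linearEquiv_conj_of_eqOn hss t.toLinearEquiv
    (conj_apply t (r i)) (agreementSubmodule_mem_invtSubmodule _ (t⁻¹ * r i * t).val N)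
    fun w hw => (mem_agreementSubmodule.1 hw).2 0
  refine ⟨.ofLinearEquiv ρ, mul_eq_mul_of_apply hρ, rank_bound _ _ _ ?_⟩
  have h1 := finrank_range_one_sub_le (ρ := ρ.toLinearMap) hfix
  have h2 := finrank_le_finrank_agreementSubmodule (r i).val (t⁻¹ * r i * t).val hN
  change finrank K (LinearMap.range (1 - ρ.toLinearMap : End K (Vec K (n i)))) ≤ 1 *
    (finrank K (LinearMap.range (1 - (r i).val ^ N)) +
      N * finrank K (LinearMap.range ((r i).val - (t⁻¹ * r i * t).val)))
  omega

/-- Semisimple torsion centralizers split in the isometry groups `G i` of form pairs. The maps `T`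
of `hT` make the Gauss sums nonzero. -/
theorem isometry_split {s : K →+* K} (hq : (q : K) = 0) (G : ∀ i, Subgroup (GLn K (n i)))
    (B : ∀ i, Vec K (n i) →ₛₗ[s] Vec K (n i) →ₗ[K] K) (D : ∀ i, Vec K (n i) × Vec K (n i) → K)
    (hBD : ∀ i, IsFormPair (B i) (D i))
    (hG : ∀ i g, g ∈ G i ↔ ∀ p : Vec K (n i) × Vec K (n i), D i (g.val p.1, g.val p.2) = D i p)
    (hT : ∀ i, ∃ T : Vec K (n i) →ₗ[K] Vec K (n i),
      ∀ p, D i p = polar (D i) (T p.1, T p.2) p) :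
    SemisimpleTorsionCentralizersSplit U (fun i => (rankNorm K (n i)).restrict (G i)) q := by
  rintro g - hg r rfl hr
  obtain ⟨N, hN, hpow⟩ := isOfFinOrder_iff_pow_eq_one.1 hg
  refine centralizer_eq_of_conj_bound U _ r N hpow ((2 : ℕ) * (N + 1)) fun i t => ?_
  have hri : (orderOf (r i).val).Coprime q := by
    rw [Subgroup.orderOf_coe]
    exact hr i
  have hss : Module.End.IsSemisimple (r i).val.val :=
    isSemisimple_of_pow_eq_one (natCast_ne_zero_of_coprime hq hri) (by
      rw [← Units.val_pow_eq_pow_val, pow_orderOf_eq_one, Units.val_one])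
  have hD := (hG i _).1 (r i).2
  obtain ⟨T₀, hT₀⟩ := hT i
  obtain ⟨T, hTg, hTD⟩ := exists_commuting_polar_eq (hBD i) _ hD hq hri T₀ hT₀
  obtain ⟨ρ, hρ, hρD, W₁, hfix, hrank⟩ := exists_isometry_conj_of_eqOn (hBD i) hD hss T hTg hTD
    t.val.toLinearEquiv ((hG i _).1 t.2) (conj_apply t.val (r i).val)
    (agreementSubmodule_mem_invtSubmodule _ (t.val⁻¹ * (r i).val * t.val).val N)
    fun w hw => (mem_agreementSubmodule.1 hw).2 0
  refine ⟨⟨.ofLinearEquiv ρ, (hG i _).2 hρD⟩, Subtype.ext (mul_eq_mul_of_apply hρ),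
    rank_bound _ (t.val⁻¹ * (r i).val * t.val) _ ?_⟩
  have h1 := finrank_range_one_sub_le (ρ := ρ.toLinearMap) hfix
  have h2 := finrank_le_finrank_agreementSubmodule (r i).val.val
    (t.val⁻¹ * (r i).val * t.val).val hN
  change finrank K (LinearMap.range (1 - ρ.toLinearMap : End K (Vec K (n i)))) ≤ 2 *
    (finrank K (LinearMap.range (1 - (r i).val.val ^ N)) +
      N * finrank K (LinearMap.range ((r i).val.val - (t.val⁻¹ * (r i).val * t.val).val)))
  omega

end Splitting

end MetUltra

theorem mainTheorem3 {I : Type*} (U : Ultrafilter I) (n : I → ℕ) (hn : Tendsto n U atTop)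
    (F : Type*) [Field F] [Fintype F] :
    -- symmetric groups
    MetUltra.TorsionCentralizersSplit U (fun i => MetUltra.hammingNorm (n i)) ∧
    -- general linear groups
    MetUltra.SemisimpleTorsionCentralizersSplit U (fun i => MetUltra.rankNorm F (n i))
      (Fintype.card F) ∧
    -- symplectic groups
    (∀ f : ∀ i, MetUltra.Vec F (n i) →ₗ[F] MetUltra.Vec F (n i) →ₗ[F] F,
      (∀ i, (f i).IsAlt ∧ (f i).Nondegenerate) →
      MetUltra.SemisimpleTorsionCentralizersSplit U
        (fun i => (MetUltra.rankNorm F (n i)).restrict (MetUltra.isometryGroup (f i)))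
        (Fintype.card F)) ∧
    -- orthogonal groups
    (∀ Q : ∀ i, QuadraticForm F (MetUltra.Vec F (n i)),
      (∀ i, (QuadraticMap.polarBilin (Q i)).Nondegenerate) →
      MetUltra.SemisimpleTorsionCentralizersSplit U
        (fun i => (MetUltra.rankNorm F (n i)).restrict (MetUltra.orthogonalGroup (Q i)))
        (Fintype.card F)) ∧
    -- unitary groups, over the quadratic extension of `F`
    (∀ (E : Type*) [Field E] [Algebra F E], Module.finrank F E = 2 →
      ∀ f : ∀ i, MetUltra.Vec E (n i) →ₛₗ[MetUltra.qFrob F E] MetUltra.Vec E (n i) →ₗ[E] E,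
      (∀ i, (f i).IsSymm ∧ (f i).Nondegenerate) →
      MetUltra.SemisimpleTorsionCentralizersSplit U
        (fun i => (MetUltra.rankNorm E (n i)).restrict (MetUltra.isometryGroup (f i)))
        (Fintype.card F)) := by
  have hq : ((Fintype.card F : ℕ) : F) = 0 := FiniteField.cast_card_eq_zero F
  refine ⟨MetUltra.hammingNorm_split U n, MetUltra.rankNorm_split U n hq, fun f hf => ?_,
    fun Q hQ => ?_, fun E _ _ hE f hf => ?_⟩
  · exact MetUltra.isometry_split U n hq _ f (fun i p => f i p.1 p.2)
      (fun i => MetUltra.isFormPair_sesquilinear (hf i).1.isRefl (hf i).2.1)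
      (fun i g => ⟨fun h p => h p.1 p.2, fun h v w => h (v, w)⟩)
      (fun i => MetUltra.exists_polar_eq_alternating (hf i).1 (hf i).2.1)
  · exact MetUltra.isometry_split U n hq _ (fun i => (Q i).polarBilin) (fun i p => Q i p.1)
      (fun i => MetUltra.isFormPair_quadratic (hQ i).1)
      (fun i g => ⟨fun h p => h p.1, fun h v => h (v, v)⟩)
      (fun i => MetUltra.exists_polar_eq_quadratic (hQ i).1)
  · have : FiniteDimensional F E := FiniteDimensional.of_finrank_pos (by omega)
    have : Finite E := Module.finite_of_finite F
    have hqE : ((Fintype.card F : ℕ) : E) = 0 := by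
      rw [← map_natCast (algebraMap F E), hq, map_zero]
    obtain ⟨c, hc⟩ := MetUltra.exists_qFrob_add_self_eq_one F E hE
    exact MetUltra.isometry_split U n hqE _ f (fun i p => f i p.1 p.2)
      (fun i => MetUltra.isFormPair_sesquilinear (hf i).1.isRefl (hf i).2.1)
      (fun i g => ⟨fun h p => h p.1 p.2, fun h v w => h (v, w)⟩)
      (fun i => MetUltra.exists_polar_eq_sesquilinear (f i) hc)
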